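/- Fix integers $n\ge 2$ and $0\le i_1<i_2\le n$, and put $d=i_2-i_1$. Let $\mathscr L$ be the set of $(v_0,\dots,v_n)\in\mathbb Z^{n+1}$ with $\sum_i v_i=0$ and $\sum_i i\,v_i=0$. For $u\in\mathbb Q$ and $v\in\mathbb Z$ let $$\gamma(u,v)=\begin{cases}1&\text{if } v=0,\\ u(u-1)\cdots(u-|v|+1)&\text{if } v<0,\\ 0&\text{if } v>0,\ u\in\mathbb Z \text{ and } 0>u\ge -v,\\ \prod_{i=1}^{v}(u+i)^{-1}&\text{otherwise,}\end{cases}$$ and for $u_0,\dots,u_n\in\mathbb Q$ define the formal series in indeterminates $a_0,\dots,a_n$ and their fractional powers $$[a_0^{u_0}\cdots a_n^{u_n}]=\sum_{(v_0,\dots,v_n)\in\mathscr L}\ \prod_{i=0}^n\gamma(u_i,v_i)\,a_i^{u_i+v_i}.$$ For $\xi\in\mathbb C$ with $\xi^d=-1$, Sturmfels' $\mathcal A$-hypergeometric series is $$X_{i_1,i_2,\xi}=\xi\,[a_{i_1}^{1/d}a_{i_2}^{-1/d}]+\frac1d\sum_{k=2}^{d}\xi^k\,[a_{i_1}^{(k-d)/d}a_{i_1+k-1}a_{i_2}^{-k/d}]+\frac1d\,[a_{i_1-1}a_{i_1}^{-1}],$$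 where $[a_{i_1-1}a_{i_1}^{-1}]$ denotes $0$ if $i_1=0$. Let $L$ be the Riemann surface of the logarithm, and for $z\in L$ and $\gamma\in\mathbb C$ let $z^\gamma=e^{\gamma\log z}$. Let $c_{i_1},c_{i_2}$ be non-zero complex numbers, parametrize $\mathbb C^{n-1}$ by the coordinates $\mathbf c=(c_i)_{0\le i\le n,\ i\ne i_1,i_2}$, and let $$g(z)=1+\frac{c_{i_2}}{c_{i_1}}z^d,\qquad f(z)=g(z)+\sum_{i\ne i_1,i_2}c_i\,z^{i-i_1}\qquad(z\in L).$$ Let $\alpha\in L$ with $g(\alpha)=0$, let $U\subset\mathbb C^{n-1}$ be a neighborhood of $\mathbf 0$, and let $\phi\colon U\to L$ be smooth (complex differentiable to all orders) with $f(\phi(\mathbf c))=0$ for all $\mathbf c\in U$ and $\phi(\mathbf 0)=\alpha$. Let $A,B,\xi\in\mathbb C$ with $A^d=c_{i_1}$, $B^d=c_{i_2}$, $\xi^d=-1$ and $\alpha=\xi A/B$ (as complex numbers). Then $X_{i_1,i_2,\xi}$ is a power series in the variables $a_i$, $i\ne i_1,i_2$ (only non-negative integer exponents of these variables occur), whose coefficients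 are Laurent polynomials in $a_{i_1}^{1/d}$ and $a_{i_2}^{1/d}$; and, as formal power series in the variables $c_i$, $i\neq i_1,i_2$, the Taylor series about $\mathbf 0$ of the complex-valued function $\mathbf c\mapsto\phi(\mathbf c/c_{i_1})$ is equal to $X_{i_1,i_2,\xi}$ under the identification $a_i=c_i$ ($i\ne i_1,i_2$), $a_{i_1}^{1/d}=A$, $a_{i_2}^{1/d}=B$. -/

import Mathlib

open scoped ContDiff Topology

noncomputable section

/-- The Riemann surface `L` of the logarithm, parametrized by
`(r, θ, n)` with `r > 0`, `θ ∈ (-π, π]` and `n ∈ ℤ`. -/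
@[ext]
structure LogSurface where
  r : ℝ
  θ : ℝ
  n : ℤ
  r_pos : 0 < r
  θ_mem : θ ∈ Set.Ioc (-Real.pi) Real.pi

namespace LogSurface

/-- The logarithm `ln r + i θ + 2 π i n`, the global holomorphic chart `L → ℂ`
that gives `L` its complex structure. -/
def log (z : LogSurface) : ℂ :=
  (Real.log z.r : ℂ) + Complex.I * (z.θ : ℂ) + 2 * (Real.pi : ℂ) * Complex.I * (z.n : ℂ)

/-- The logarithm is a bijection from `L` onto `ℂ`. -/
theorem log_bijective : Function.Bijective log := by
  constructor
  · intro z w h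
    have hre := congrArg Complex.re h
    have him := congrArg Complex.im h
    simp [log] at hre him
    have hr : z.r = w.r := Real.log_injOn_pos z.r_pos w.r_pos hre
    have hz := z.θ_mem
    have hw := w.θ_mem
    have hpi := Real.pi_pos
    have hn : z.n = w.n := by
      by_contra hne
      rcases lt_or_gt_of_ne hne with hlt | hlt
      · have h1 : (z.n : ℝ) + 1 ≤ w.n := by exact_mod_cast hlt
        nlinarith [hz.1, hz.2, hw.1, hw.2]
      · have h1 : (w.n : ℝ) + 1 ≤ z.n := by exact_mod_cast hlt
        nlinarith [hz.1, hz.2, hw.1, hw.2]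
    have hθ : z.θ = w.θ := by
      rw [hn] at him
      linarith
    exact LogSurface.ext hr hθ hn
  · intro w
    refine ⟨⟨Real.exp w.re, toIocMod Real.two_pi_pos (-Real.pi) w.im,
      toIocDiv Real.two_pi_pos (-Real.pi) w.im, Real.exp_pos _, ?_⟩, ?_⟩
    · have h := toIocMod_mem_Ioc Real.two_pi_pos (-Real.pi) w.im
      have e : -Real.pi + 2 * Real.pi = Real.pi := by ring
      rwa [e] at h
    · have h := toIocMod_add_toIocDiv_zsmul Real.two_pi_pos (-Real.pi) w.im
      rw [zsmul_eq_mul] at h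
      apply Complex.ext
      · simp [log]
      · simp [log]
        linarith

/-- The complex power `z ^ γ = e ^ (γ ln r + i γ θ + 2 π i n γ)` of a point of `L`. -/
def pow (z : LogSurface) (γ : ℂ) : ℂ :=
  Complex.exp (γ * (Real.log z.r : ℂ) + Complex.I * γ * (z.θ : ℂ)
    + 2 * (Real.pi : ℂ) * Complex.I * (z.n : ℂ) * γ)

/-- The complex number `z ^ 1 = r e ^ (i θ)` lying under a point `z` of `L`. -/
def toComplex (z : LogSurface) : ℂ := z.pow 1

end LogSurface

/-- The base function `g(z) = 1 + b z ^ β` on `L`. -/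
def baseFunction (b β : ℂ) (z : LogSurface) : ℂ := 1 + b * z.pow β

/-- The complex-exponent polynomial `f(z) = 1 + b z ^ β + ∑ i, a i z ^ γ i` on `L`. -/
def modifiedFunction {σ : Type} [Fintype σ] (b β : ℂ) (a γ : σ → ℂ) (z : LogSurface) : ℂ :=
  baseFunction b β z + ∑ i, a i * z.pow (γ i)

/-- A map from `ℂ ^ σ` to `L` is smooth on `U` (complex differentiable to all orders) when it is so
in the chart `log`. -/
def SmoothToLogSurface {σ : Type} [Fintype σ] (φ : (σ → ℂ) → LogSurface) (U : Set (σ → ℂ)) : Prop :=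
  ContDiffOn ℂ ∞ (fun c => (φ c).log) U

/-- The partial derivative `∂ / ∂ c_i`. -/
def partialDeriv {σ : Type} [Fintype σ] [DecidableEq σ] (i : σ) (ψ : (σ → ℂ) → ℂ) :
    (σ → ℂ) → ℂ :=
  fun c => lineDeriv ℂ ψ c (Pi.single i 1)

/-- The operator `∏ i, (∂ / ∂ c_i) ^ (m i)`, composed in the order of the indices. -/
def iteratedPartial {σ : Type} [Fintype σ] [LinearOrder σ] (m : σ →₀ ℕ) (ψ : (σ → ℂ) → ℂ) :
    (σ → ℂ) → ℂ :=
  ((Finset.univ : Finset σ).sort (· ≤ ·)).foldr (fun i F => (partialDeriv i)^[m i] F) ψ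

/-- The Taylor series about `0` of a function of the variables `c_i`, `i : σ`, as a formal power
series: the coefficient of `∏ c_i ^ (m i)` is `(∂_m ψ)(0) / ∏ (m i)!`. -/
def taylorSeries {σ : Type} [Fintype σ] [LinearOrder σ] (ψ : (σ → ℂ) → ℂ) : MvPowerSeries σ ℂ :=
  fun m => iteratedPartial m ψ 0 / ((∏ i, (m i).factorial : ℕ) : ℂ)

/-- The matrix with rows `(0, 1, …, n)` and `(1, 1, …, 1)`. -/
def hyperMatrix (n : ℕ) : Matrix (Fin 2) (Fin (n + 1)) ℚ :=
  Matrix.of ![fun j => ((j : ℕ) : ℚ), fun _ => 1]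

/-- The integer vectors in the kernel of `hyperMatrix n`. -/
def kernelLattice (n : ℕ) : Set (Fin (n + 1) → ℤ) :=
  {v | (hyperMatrix n).mulVec (fun i => (v i : ℚ)) = 0}

open Classical in
/-- The coefficients `γ(u, v)`, equal to `u! / (u + v)!` if `u` is not a negative integer. -/
def gammaCoeff (u : ℚ) (v : ℤ) : ℚ :=
  if v = 0 then 1
  else if v < 0 then ∏ i ∈ Finset.Icc 1 v.natAbs, (u - (i : ℚ) + 1)
  else if (∃ w : ℤ, u = (w : ℚ)) ∧ u < 0 ∧ -(v : ℚ) ≤ u then 0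
  else 1 / ∏ i ∈ Finset.Icc 1 v.natAbs, (u + (i : ℚ))

/-- Formal series `∑ e, x_e a_0 ^ e_0 ⋯ a_n ^ e_n` with rational exponents in the indeterminates
`a_0, …, a_n`, and complex coefficients `x_e`. -/
abbrev FormalSeries (n : ℕ) : Type := (Fin (n + 1) → ℚ) → ℂ

/-- The bracket series `[a ^ u] = ∑_{v ∈ 𝓛} ∏ i, γ(u_i, v_i) a_i ^ (u_i + v_i)`. For every exponent
`e` at most one `v` has `u + v = e`. -/
def bracketSeries {n : ℕ} (u : Fin (n + 1) → ℚ) : FormalSeries n :=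
  fun e => ∑ᶠ v ∈ kernelLattice n,
    if (fun i => u i + (v i : ℚ)) = e then ((∏ i, gammaCoeff (u i) (v i) : ℚ) : ℂ) else 0

/-- The exponent vector of the monomial `a_j ^ q`. -/
def monoExp (n j : ℕ) (q : ℚ) : Fin (n + 1) → ℚ := fun i => if (i : ℕ) = j then q else 0

/-- Sturmfels' series
`ξ [a_{i₁}^{1/d} a_{i₂}^{-1/d}] + (1/d) ∑_{k=2}^{d} ξ^k [a_{i₁}^{(k-d)/d} a_{i₁+k-1} a_{i₂}^{-k/d}]
  + (1/d) [a_{i₁-1} a_{i₁}^{-1}]`, where `d = i₂ - i₁` and the last bracket is `0` if `i₁ = 0`. -/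
def sturmfelsSeries (n i₁ i₂ : ℕ) (ξ : ℂ) : FormalSeries n :=
  let d : ℕ := i₂ - i₁
  ξ • bracketSeries (monoExp n i₁ (1 / (d : ℚ)) + monoExp n i₂ (-1 / (d : ℚ)))
  + (1 / (d : ℂ)) • ∑ k ∈ Finset.Icc 2 d, ξ ^ k •
      bracketSeries (monoExp n i₁ (((k : ℚ) - (d : ℚ)) / (d : ℚ)) + monoExp n (i₁ + k - 1) 1
        + monoExp n i₂ (-(k : ℚ) / (d : ℚ)))
  + (1 / (d : ℂ)) • (if i₁ = 0 then 0 else bracketSeries (monoExp n (i₁ - 1) 1 + monoExp n i₁ (-1)))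

/-- The indices `0 ≤ i ≤ n` other than `i₁` and `i₂`. -/
abbrev OtherIndex {n : ℕ} (i₁ i₂ : Fin (n + 1)) : Type := {i : Fin (n + 1) // i ≠ i₁ ∧ i ≠ i₂}

/-- The exponent vector of `a_{i₁} ^ (p/d) a_{i₂} ^ (q/d) ∏_{i ≠ i₁, i₂} a_i ^ (m i)`. -/
def mixedExp {n : ℕ} (i₁ i₂ : Fin (n + 1)) (d : ℕ) (m : OtherIndex i₁ i₂ →₀ ℕ) (p q : ℤ) :
    Fin (n + 1) → ℚ :=
  fun i => if h : i ≠ i₁ ∧ i ≠ i₂ then (m ⟨i, h⟩ : ℚ)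
    else if i = i₁ then (p : ℚ) / (d : ℚ) else (q : ℚ) / (d : ℚ)

/-- The formal series `X` is a power series in the `a_i`, `i ≠ i₁, i₂`, whose coefficients are
Laurent polynomials in `a_{i₁} ^ (1/d)` and `a_{i₂} ^ (1/d)`. -/
def IsPowerSeriesOutside {n : ℕ} (i₁ i₂ : Fin (n + 1)) (d : ℕ) (X : FormalSeries n) : Prop :=
  (∀ e, X e ≠ 0 → ∃ (m : OtherIndex i₁ i₂ →₀ ℕ) (p q : ℤ), e = mixedExp i₁ i₂ d m p q) ∧
  ∀ m : OtherIndex i₁ i₂ →₀ ℕ, {t : ℤ × ℤ | X (mixedExp i₁ i₂ d m t.1 t.2) ≠ 0}.Finite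

/-- The power series in the `a_i`, `i ≠ i₁, i₂`, obtained from a formal series that satisfies
`IsPowerSeriesOutside` by giving `a_{i₁} ^ (1/d)` and `a_{i₂} ^ (1/d)` the values `A` and `B`. -/
def specializeSeries {n : ℕ} (i₁ i₂ : Fin (n + 1)) (d : ℕ) (A B : ℂ) (X : FormalSeries n) :
    MvPowerSeries (OtherIndex i₁ i₂) ℂ :=
  fun m => ∑ᶠ t : ℤ × ℤ, X (mixedExp i₁ i₂ d m t.1 t.2) * A ^ t.1 * B ^ t.2

end

/-!
Both series are computed coefficient by coefficient, for a multi-index `m` in the variables other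
than `a_{i₁}`, `a_{i₂}`. Put `M = ∑ m_i` and `s = 1 + ∑ (i - i₁) m_i` (`rootWeight`). The common
value of the coefficients is, for `m ≠ 0`,
`ξ ^ s A ^ (s - d M) B ^ (-s) (1 / d) ∏_{j = 1}^{M - 1} (s / d - j) / ∏ m_i!`,
and `ξ A / B` for `m = 0`.

*The Taylor series.* After rescaling, `t = log φ` satisfies
`c₁ + c₂ e ^ (d t) + ∑ c_i e ^ (γ_i t) = 0` with `γ_i = i - i₁`. Let
`w_r = e ^ (r t) ∂t / ∂c₁`, written explicitly as a quotient (`weightedRoot`), so that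
`c₁` need not be varied. Lagrange inversion rests on
`∂_i w_r = ∂ w_{r + γ_i} / ∂c₁`; the homogeneity of the equation turns the right-hand side into an
expression in `w_{r + γ_i}` and the Euler operators `c_j ∂_j` (`partialDeriv_weightedRoot`). Since
`c_j ∂_j` multiplies the Taylor coefficient of index `m` by `m_j`, this is a recursion for the
Taylor coefficients of `w_r` at `0`, and `∂_i e ^ t = w_{1 + γ_i}` gives those of `φ`
(`iteratedPartial_exp_root`).

*Sturmfels' series.* The exponents of every bracket satisfy the same two linear equations, which
leave a single monomial `a_{i₁} ^ (s / d - M) a_{i₂} ^ (-s / d)` for each `m`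
(`exists_eq_soleExp`). Write `s = k + d N` with `1 ≤ k ≤ d`. Integrality of the exponent shifts
allows only the bracket of index `k` (the initial one if `k = 1`) and, if `k = d`, the last one.
The functional equation of `γ(u, v)` extracts the product over `j`, leaving
`γ(k / d - 1, N) γ(-k / d, -N)`, which is `(-1) ^ N` by the reflection formula if `k < d`. If
`k = d`, the bracket of index `d` gives this value for `N ≥ 0` and vanishes for `N < 0`, where the
last bracket takes over (`bracketSeries_last_eq_ite`). Finally `ξ ^ k (-1) ^ N = ξ ^ s`.
-/

/-! ### Iterated partial derivatives -/

/-- Induction on a multi-index, raising one entry by one at a time. -/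
theorem Finsupp.induction_add_single_one {σ : Type*} {p : (σ →₀ ℕ) → Prop} (m : σ →₀ ℕ)
    (zero : p 0) (add_single : ∀ m i, p m → p (m + Finsupp.single i 1)) : p m := by
  induction m using Finsupp.induction with
  | zero => exact zero
  | single_add i k f _ hk hf =>
    clear hk
    induction k with
    | zero => simpa using hf
    | succ k ih =>
      rw [Finsupp.single_add, add_right_comm]
      exact add_single _ i ih

section PartialDerivatives

variable {σ : Type} [Fintype σ] {V : Set (σ → ℂ)} {ψ χ : (σ → ℂ) → ℂ}

theorem partialDeriv_eq_fderiv [DecidableEq σ] {c : σ → ℂ} (h : DifferentiableAt ℂ ψ c) (i : σ) :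
    partialDeriv i ψ c = fderiv ℂ ψ c (Pi.single i 1) :=
  h.lineDeriv_eq_fderiv

theorem partialDeriv_congr [DecidableEq σ] (hV : IsOpen V) (h : Set.EqOn ψ χ V) (i : σ) :
    Set.EqOn (partialDeriv i ψ) (partialDeriv i χ) V := fun _ hc =>
  (h.eventuallyEq_of_mem (hV.mem_nhds hc)).lineDeriv_eq

theorem ContDiffOn.differentiableAt_of_isOpen (hψ : ContDiffOn ℂ ∞ ψ V) (hV : IsOpen V)
    {c : σ → ℂ} (hc : c ∈ V) : DifferentiableAt ℂ ψ c :=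
  (hψ.contDiffAt (hV.mem_nhds hc)).differentiableAt (by simp)

theorem partialDeriv_eqOn_fderiv [DecidableEq σ] (hV : IsOpen V) (hψ : ContDiffOn ℂ ∞ ψ V)
    (i : σ) : Set.EqOn (partialDeriv i ψ) (fun c => fderiv ℂ ψ c (Pi.single i 1)) V :=
  fun _ hc => partialDeriv_eq_fderiv (hψ.differentiableAt_of_isOpen hV hc) i

theorem ContDiffOn.fderiv_apply_const (hV : IsOpen V) (hψ : ContDiffOn ℂ ∞ ψ V) (x : σ → ℂ) :
    ContDiffOn ℂ ∞ (fun c => fderiv ℂ ψ c x) V :=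
  (hψ.fderiv_of_isOpen hV (by simp)).clm_apply contDiffOn_const

theorem ContDiffOn.partialDeriv [DecidableEq σ] (hV : IsOpen V) (hψ : ContDiffOn ℂ ∞ ψ V)
    (i : σ) : ContDiffOn ℂ ∞ (_root_.partialDeriv i ψ) V :=
  (hψ.fderiv_apply_const hV _).congr (partialDeriv_eqOn_fderiv hV hψ i)

theorem partialDeriv_comm [DecidableEq σ] (hV : IsOpen V) (hψ : ContDiffOn ℂ ∞ ψ V) (i j : σ) :
    Set.EqOn (partialDeriv i (partialDeriv j ψ)) (partialDeriv j (partialDeriv i ψ)) V := by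
  have key : ∀ i j : σ, ∀ c ∈ V, partialDeriv i (partialDeriv j ψ) c =
      fderiv ℂ (fderiv ℂ ψ) c (Pi.single i 1) (Pi.single j 1) := by
    intro i j c hc
    rw [partialDeriv_congr hV (partialDeriv_eqOn_fderiv hV hψ j) i hc,
      partialDeriv_eq_fderiv ((hψ.fderiv_apply_const hV _).differentiableAt_of_isOpen hV hc)]
    have hd : DifferentiableAt ℂ (fderiv ℂ ψ) c :=
      ((hψ.fderiv_of_isOpen (m := ∞) hV (by simp)).contDiffAt
        (hV.mem_nhds hc)).differentiableAt (by simp)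
    rw [fderiv_clm_apply hd (differentiableAt_const _)]
    simp
  intro c hc
  rw [key i j c hc, key j i c hc]
  exact ((hψ.contDiffAt (hV.mem_nhds hc)).isSymmSndFDerivAt
    (by simpa using WithTop.coe_le_coe.2 (le_top : (2 : ℕ∞) ≤ ⊤))).eq _ _

theorem partialDeriv_add [DecidableEq σ] (hV : IsOpen V) (hψ : ContDiffOn ℂ ∞ ψ V)
    (hχ : ContDiffOn ℂ ∞ χ V) (i : σ) :
    Set.EqOn (partialDeriv i (fun c => ψ c + χ c))
      (fun c => partialDeriv i ψ c + partialDeriv i χ c) V := by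
  intro c hc
  have h1 := hψ.differentiableAt_of_isOpen hV hc
  have h2 := hχ.differentiableAt_of_isOpen hV hc
  simp only
  rw [partialDeriv_eq_fderiv h1, partialDeriv_eq_fderiv h2, partialDeriv_eq_fderiv (h1.fun_add h2),
    fderiv_fun_add h1 h2]
  rfl

theorem partialDeriv_mul [DecidableEq σ] (hV : IsOpen V) (hψ : ContDiffOn ℂ ∞ ψ V)
    (hχ : ContDiffOn ℂ ∞ χ V) (i : σ) :
    Set.EqOn (partialDeriv i (fun c => ψ c * χ c))
      (fun c => ψ c * partialDeriv i χ c + partialDeriv i ψ c * χ c) V := by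
  intro c hc
  have h1 := hψ.differentiableAt_of_isOpen hV hc
  have h2 := hχ.differentiableAt_of_isOpen hV hc
  simp only
  rw [partialDeriv_eq_fderiv h1, partialDeriv_eq_fderiv h2, partialDeriv_eq_fderiv (h1.fun_mul h2),
    fderiv_fun_mul h1 h2]
  simp [mul_comm]

theorem partialDeriv_const [DecidableEq σ] (a : ℂ) (i : σ) (c : σ → ℂ) :
    partialDeriv i (fun _ => a) c = 0 := by
  simp [partialDeriv_eq_fderiv (differentiableAt_const a)]

theorem contDiffOn_coord (j : σ) : ContDiffOn ℂ ∞ (fun c : σ → ℂ => c j) V :=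
  (contDiff_apply ℂ ℂ j).contDiffOn

theorem partialDeriv_const_mul [DecidableEq σ] (hV : IsOpen V) (hψ : ContDiffOn ℂ ∞ ψ V)
    (a : ℂ) (i : σ) :
    Set.EqOn (partialDeriv i (fun c => a * ψ c)) (fun c => a * partialDeriv i ψ c) V := by
  intro c hc
  rw [partialDeriv_mul hV contDiffOn_const hψ i hc]
  simp [partialDeriv_const]

/-- An operator on functions that, on the smooth functions on `V`, depends only on the values
on `V`, preserves smoothness, is linear and commutes with all partial derivatives. -/
structure IsSmoothOperator [DecidableEq σ] (V : Set (σ → ℂ))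
    (T : ((σ → ℂ) → ℂ) → ((σ → ℂ) → ℂ)) : Prop where
  congr : ∀ {ψ χ}, Set.EqOn ψ χ V → Set.EqOn (T ψ) (T χ) V
  contDiffOn : ∀ {ψ}, ContDiffOn ℂ ∞ ψ V → ContDiffOn ℂ ∞ (T ψ) V
  add : ∀ {ψ χ}, ContDiffOn ℂ ∞ ψ V → ContDiffOn ℂ ∞ χ V →
    Set.EqOn (T (fun c => ψ c + χ c)) (fun c => T ψ c + T χ c) V
  const_mul : ∀ {ψ} (a : ℂ), ContDiffOn ℂ ∞ ψ V →
    Set.EqOn (T (fun c => a * ψ c)) (fun c => a * T ψ c) V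
  comm : ∀ {ψ} (i : σ), ContDiffOn ℂ ∞ ψ V →
    Set.EqOn (T (partialDeriv i ψ)) (partialDeriv i (T ψ)) V

namespace IsSmoothOperator

variable [DecidableEq σ]

theorem id : IsSmoothOperator V (fun ψ => ψ) :=
  ⟨fun h => h, fun h => h, fun _ _ _ _ => rfl, fun _ _ _ _ => rfl, fun _ _ _ _ => rfl⟩

theorem comp {S T : ((σ → ℂ) → ℂ) → ((σ → ℂ) → ℂ)} (hS : IsSmoothOperator V S)
    (hT : IsSmoothOperator V T) : IsSmoothOperator V (fun ψ => S (T ψ)) where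
  congr h := hS.congr (hT.congr h)
  contDiffOn h := hS.contDiffOn (hT.contDiffOn h)
  add h h' := (hS.congr (hT.add h h')).trans (hS.add (hT.contDiffOn h) (hT.contDiffOn h'))
  const_mul a h := (hS.congr (hT.const_mul a h)).trans (hS.const_mul a (hT.contDiffOn h))
  comm i h := (hS.congr (hT.comm i h)).trans (hS.comm i (hT.contDiffOn h))

theorem partialDeriv (hV : IsOpen V) (i : σ) : IsSmoothOperator V (_root_.partialDeriv i) where
  congr h := partialDeriv_congr hV h i
  contDiffOn h := h.partialDeriv hV i
  add h h' := partialDeriv_add hV h h' i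
  const_mul a h := partialDeriv_const_mul hV h a i
  comm j h := partialDeriv_comm hV h i j

theorem iterate (hV : IsOpen V) (i : σ) (k : ℕ) :
    IsSmoothOperator V ((_root_.partialDeriv i)^[k]) := by
  induction k with
  | zero => exact IsSmoothOperator.id
  | succ k ih =>
    rw [Function.iterate_succ']
    exact (IsSmoothOperator.partialDeriv hV i).comp ih

theorem foldr (hV : IsOpen V) (m : σ → ℕ) (l : List σ) :
    IsSmoothOperator V
      (fun ψ => l.foldr (fun i F => (_root_.partialDeriv i)^[m i] F) ψ) := by
  induction l with
  | nil => exact IsSmoothOperator.id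
  | cons i l ih => exact (iterate hV i (m i)).comp ih

end IsSmoothOperator

variable [LinearOrder σ]

theorem isSmoothOperator_iteratedPartial (hV : IsOpen V) (m : σ →₀ ℕ) :
    IsSmoothOperator V (iteratedPartial m) :=
  IsSmoothOperator.foldr hV m _

theorem iteratedPartial_zero (ψ : (σ → ℂ) → ℂ) : iteratedPartial 0 ψ = ψ := by
  unfold iteratedPartial
  induction (Finset.univ : Finset σ).sort (· ≤ ·) with
  | nil => rfl
  | cons i l ih => simp

/-- One more derivative in the variable `c_i` may be applied first, by the symmetry of second
derivatives. -/
theorem iteratedPartial_add_single (hV : IsOpen V) (hψ : ContDiffOn ℂ ∞ ψ V) (m : σ →₀ ℕ)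
    (i : σ) :
    Set.EqOn (iteratedPartial (m + Finsupp.single i 1) ψ) (iteratedPartial m (partialDeriv i ψ))
      V := by
  have hfold : ∀ l : List σ, i ∉ l →
      l.foldr (fun j F => (partialDeriv j)^[(m + Finsupp.single i 1 : σ →₀ ℕ) j] F) ψ =
        l.foldr (fun j F => (partialDeriv j)^[m j] F) ψ := by
    intro l hl
    induction l with
    | nil => rfl
    | cons j l ih =>
      simp only [List.mem_cons, not_or] at hl
      simp only [List.foldr_cons]
      rw [ih hl.2]
      simp [hl.1]
  have key : ∀ l : List σ, l.Nodup → i ∈ l →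
      Set.EqOn (l.foldr (fun j F => (partialDeriv j)^[(m + Finsupp.single i 1 : σ →₀ ℕ) j] F) ψ)
        (l.foldr (fun j F => (partialDeriv j)^[m j] F) (partialDeriv i ψ)) V := by
    intro l hl hil
    induction l with
    | nil => simp at hil
    | cons j l ih =>
      rw [List.nodup_cons] at hl
      simp only [List.foldr_cons]
      by_cases hij : i = j
      · subst hij
        rw [hfold l hl.1]
        simp only [Finsupp.coe_add, Pi.add_apply, Finsupp.single_eq_same, Function.iterate_succ,
          Function.comp_apply]
        exact (IsSmoothOperator.iterate hV i (m i)).congr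
          ((IsSmoothOperator.foldr hV m l).comm i hψ).symm
      · have : (m + Finsupp.single i 1 : σ →₀ ℕ) j = m j := by simp [hij]
        rw [this]
        refine (IsSmoothOperator.iterate hV j (m j)).congr (ih hl.2 ?_)
        simpa [hij] using hil
  exact key _ (Finset.sort_nodup _ _) (by simp)

theorem iteratedPartial_sum (hV : IsOpen V) {ι : Type} (s : Finset ι)
    {F : ι → (σ → ℂ) → ℂ} (hF : ∀ k, ContDiffOn ℂ ∞ (F k) V) (m : σ →₀ ℕ) :
    Set.EqOn (iteratedPartial m (fun c => ∑ k ∈ s, F k c))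
      (fun c => ∑ k ∈ s, iteratedPartial m (F k) c) V := by
  classical
  have hT := isSmoothOperator_iteratedPartial hV m
  induction s using Finset.induction_on with
  | empty =>
    intro c hc
    simpa using hT.const_mul (ψ := fun _ => 0) 0 contDiffOn_const hc
  | insert k s hk ih =>
    intro c hc
    simp only [Finset.sum_insert hk]
    exact (hT.add (hF k) (ContDiffOn.sum fun j _ => hF j) hc).trans (congrArg _ (ih hc))

theorem ContDiffOn.hasLineDerivAt (hV : IsOpen V) (hψ : ContDiffOn ℂ ∞ ψ V) (i : σ)
    {c : σ → ℂ} (hc : c ∈ V) :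
    HasLineDerivAt ℂ ψ (_root_.partialDeriv i ψ c) c (Pi.single i 1) :=
  (hψ.differentiableAt_of_isOpen hV hc).lineDifferentiableAt.hasLineDerivAt

theorem hasLineDerivAt_coord (i j : σ) (c : σ → ℂ) :
    HasLineDerivAt ℂ (fun c : σ → ℂ => c j) (if i = j then 1 else 0) c (Pi.single i 1) := by
  have := (hasFDerivAt_apply (𝕜 := ℂ) j c).hasLineDerivAt (Pi.single i 1)
  simpa [Pi.single_apply, eq_comm] using this

/-- The Euler operator `c_j ∂ / ∂ c_j` multiplies the Taylor coefficient of index `m`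
by `m j`. -/
theorem iteratedPartial_coord_mul_partialDeriv (hV : IsOpen V) (h0 : (0 : σ → ℂ) ∈ V)
    (j : σ) (m : σ →₀ ℕ) (hψ : ContDiffOn ℂ ∞ ψ V) :
    iteratedPartial m (fun c => c j * partialDeriv j ψ c) 0 = m j * iteratedPartial m ψ 0 := by
  induction m using Finsupp.induction_add_single_one generalizing ψ with
  | zero => simp [iteratedPartial_zero]
  | add_single m i ih =>
    have hT := isSmoothOperator_iteratedPartial hV m
    have hi := hψ.partialDeriv hV i
    have hj := hψ.partialDeriv hV j
    have hmul : ContDiffOn ℂ ∞ (fun c => c j * partialDeriv j ψ c) V :=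
      (contDiffOn_coord j).mul hj
    have hleib : Set.EqOn (partialDeriv i (fun c => c j * partialDeriv j ψ c))
        (fun c => c j * partialDeriv j (partialDeriv i ψ) c
          + (if i = j then 1 else 0) * partialDeriv i ψ c) V := by
      intro c hc
      rw [partialDeriv_mul hV (contDiffOn_coord j) hj i hc]
      simp only
      rw [partialDeriv_comm hV hψ i j hc,
        show partialDeriv i (fun c : σ → ℂ => c j) c = _ from
          (hasLineDerivAt_coord i j c).lineDeriv]
      split_ifs with h
      · rw [h]
      · simp
    rw [iteratedPartial_add_single hV hmul m i h0, hT.congr hleib h0,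
      hT.add ((contDiffOn_coord j).mul (hi.partialDeriv hV j)) (contDiffOn_const.mul hi) h0,
      iteratedPartial_add_single hV hψ m i h0]
    simp only
    rw [hT.const_mul _ hi h0, ih hi]
    by_cases h : i = j
    · subst h; simp; ring
    · simp [h]

end PartialDerivatives

/-! ### Taylor coefficients of powers of a root -/

section Root

variable {σ : Type} [Fintype σ] {V : Set (σ → ℂ)} {t : (σ → ℂ) → ℂ} {γ : σ → ℂ} {β c₁ c₂ : ℂ}

/-- The denominator `β c₁ - ∑ j, (γ j - β) c_j e ^ (γ j t)`. At a root `e ^ t` of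
`c₁ + c₂ z ^ β + ∑ j, c_j z ^ γ j` it is `-z ∂ / ∂ z` of this function. -/
noncomputable def rootDenom (γ : σ → ℂ) (β c₁ : ℂ) (t : (σ → ℂ) → ℂ) (c : σ → ℂ) : ℂ :=
  β * c₁ - ∑ j, (γ j - β) * (c j * Complex.exp (γ j * t c))

/-- The function `z ^ r ∂ (log z) / ∂ c₁` of a root `z = e ^ t`. -/
noncomputable def weightedRoot (γ : σ → ℂ) (β c₁ : ℂ) (t : (σ → ℂ) → ℂ) (r : ℂ) (c : σ → ℂ) : ℂ :=
  Complex.exp (r * t c) / rootDenom γ β c₁ t c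

theorem rootDenom_zero : rootDenom γ β c₁ t 0 = β * c₁ := by simp [rootDenom]

theorem contDiffOn_rootDenom (ht : ContDiffOn ℂ ∞ t V) :
    ContDiffOn ℂ ∞ (rootDenom γ β c₁ t) V :=
  contDiffOn_const.sub (ContDiffOn.sum fun j _ =>
    contDiffOn_const.mul ((contDiffOn_coord j).mul (contDiffOn_const.mul ht).cexp))

theorem contDiffOn_weightedRoot (ht : ContDiffOn ℂ ∞ t V)
    (hq : ∀ c ∈ V, rootDenom γ β c₁ t c ≠ 0) (r : ℂ) :
    ContDiffOn ℂ ∞ (weightedRoot γ β c₁ t r) V :=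
  (contDiffOn_const.mul ht).cexp.div (contDiffOn_rootDenom ht) hq

variable [LinearOrder σ]

theorem hasLineDerivAt_sum_exp (hV : IsOpen V) (ht : ContDiffOn ℂ ∞ t V) (a : σ → ℂ) (i : σ)
    {c : σ → ℂ} (hc : c ∈ V) :
    HasLineDerivAt ℂ (fun c => ∑ j, a j * (c j * Complex.exp (γ j * t c)))
      (a i * Complex.exp (γ i * t c)
        + (∑ j, a j * γ j * (c j * Complex.exp (γ j * t c))) * partialDeriv i t c)
      c (Pi.single i 1) := by
  have hti : HasDerivAt _ _ _ := ht.hasLineDerivAt hV i hc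
  have hsum := HasDerivAt.fun_sum (u := Finset.univ) fun j _ =>
    (HasDerivAt.mul (hasLineDerivAt_coord i j c) (hti.const_mul (γ j)).cexp).const_mul (a j)
  refine HasDerivAt.congr_deriv hsum ?_
  simp only [zero_smul, add_zero, mul_add, Finset.sum_add_distrib, Finset.sum_mul]
  congr 1
  · simp
  · exact Finset.sum_congr rfl fun j _ => by ring

theorem partialDeriv_root (hV : IsOpen V) (ht : ContDiffOn ℂ ∞ t V)
    (hroot : ∀ c ∈ V, c₁ + c₂ * Complex.exp (β * t c) + ∑ j, c j * Complex.exp (γ j * t c) = 0)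
    (hq : ∀ c ∈ V, rootDenom γ β c₁ t c ≠ 0) (i : σ) {c : σ → ℂ} (hc : c ∈ V) :
    partialDeriv i t c = weightedRoot γ β c₁ t (γ i) c := by
  have hti : HasDerivAt _ _ _ := ht.hasLineDerivAt hV i hc
  have h1 := (((hti.const_mul β).cexp.const_mul c₂).const_add c₁).fun_add
    (hasLineDerivAt_sum_exp (γ := γ) hV ht (fun _ => 1) i hc)
  have h2 : HasLineDerivAt ℂ
      (fun c => c₁ + c₂ * Complex.exp (β * t c) + ∑ j, c j * Complex.exp (γ j * t c))
      0 c (Pi.single i 1) :=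
    ((hasFDerivAt_const (0 : ℂ) c).hasLineDerivAt _).congr_of_eventuallyEq
      (Filter.eventuallyEq_of_mem (hV.mem_nhds hc) hroot)
  have h3 := HasDerivAt.unique h2 (by simpa only [one_mul] using h1)
  have hr := hroot c hc
  have hne := hq c hc
  rw [weightedRoot, eq_div_iff hne, rootDenom]
  simp only [zero_smul, add_zero, sub_mul, Finset.sum_sub_distrib,
    ← Finset.mul_sum] at h3 ⊢
  linear_combination h3 + β * partialDeriv i t c * hr

/-- The differential equation behind Lagrange inversion: differentiating in `c_i` amounts to
multiplying by `z ^ γ i` and differentiating in `c₁`, and by homogeneity the latter is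
expressed through the Euler operators `c_j ∂ / ∂ c_j`. -/
theorem partialDeriv_weightedRoot (hV : IsOpen V) (ht : ContDiffOn ℂ ∞ t V)
    (hroot : ∀ c ∈ V, c₁ + c₂ * Complex.exp (β * t c) + ∑ j, c j * Complex.exp (γ j * t c) = 0)
    (hq : ∀ c ∈ V, rootDenom γ β c₁ t c ≠ 0) (hβ : β ≠ 0) (hc₁ : c₁ ≠ 0) (i : σ) (r : ℂ) :
    Set.EqOn (partialDeriv i (weightedRoot γ β c₁ t r))
      (fun c => (((r + γ i) / β - 1) / c₁) * weightedRoot γ β c₁ t (r + γ i) c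
        + ∑ j, ((γ j / β - 1) / c₁) *
          (c j * partialDeriv j (weightedRoot γ β c₁ t (r + γ i)) c)) V := by
  intro c hc
  set q := rootDenom γ β c₁ t c with hqdef
  set P := ∑ j, (γ j - β) * γ j * (c j * Complex.exp (γ j * t c)) with hP
  have hne : q ≠ 0 := hq c hc
  have key : ∀ (k : σ) (r : ℂ), partialDeriv k (weightedRoot γ β c₁ t r) c =
      Complex.exp (r * t c) * Complex.exp (γ k * t c) * (r + γ k - β + P / q) / q ^ 2 := by
    intro k r
    have hti : HasDerivAt _ _ _ := ht.hasLineDerivAt hV k hc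
    have hD := (hasLineDerivAt_sum_exp (γ := γ) hV ht (fun j => γ j - β) k hc).const_sub (β * c₁)
    have := (hti.const_mul r).cexp.div hD (by simpa [rootDenom] using hq c hc)
    have h4 : HasLineDerivAt ℂ (weightedRoot γ β c₁ t r) _ c (Pi.single k 1) := this
    rw [partialDeriv, h4.lineDeriv]
    simp only [zero_smul, add_zero]
    rw [partialDeriv_root hV ht hroot hq k hc, weightedRoot, ← hP, ← hqdef,
      show β * c₁ - ∑ j, (γ j - β) * (c j * Complex.exp (γ j * t c)) = q from rfl]
    field_simp
    ring
  simp only [key, weightedRoot, ← hqdef, add_mul r (γ i), Complex.exp_add]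
  have hS : ∑ j, (γ j - β) * (c j * Complex.exp (γ j * t c)) = β * c₁ - q := by
    rw [hqdef, rootDenom]; ring
  have hsum : ∑ j, (γ j / β - 1) / c₁ * (c j * (Complex.exp (r * t c) * Complex.exp (γ i * t c) *
      Complex.exp (γ j * t c) * (r + γ i + γ j - β + P / q) / q ^ 2)) =
      Complex.exp (r * t c) * Complex.exp (γ i * t c) / (q ^ 2 * β * c₁) *
        ((r + γ i - β + P / q) * (β * c₁ - q) + P) := by
    rw [← hS, hP, ← hP, Finset.mul_sum, hP, ← Finset.sum_add_distrib, ← hP, Finset.mul_sum]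
    refine Finset.sum_congr rfl fun j _ => ?_
    field_simp
    ring
  rw [hsum]
  field_simp
  ring

/-- The Taylor coefficients of the weighted root, from `partialDeriv_weightedRoot`. -/
theorem iteratedPartial_weightedRoot (hV : IsOpen V) (h0 : (0 : σ → ℂ) ∈ V)
    (ht : ContDiffOn ℂ ∞ t V)
    (hroot : ∀ c ∈ V, c₁ + c₂ * Complex.exp (β * t c) + ∑ j, c j * Complex.exp (γ j * t c) = 0)
    (hq : ∀ c ∈ V, rootDenom γ β c₁ t c ≠ 0) (hβ : β ≠ 0) (hc₁ : c₁ ≠ 0) (m : σ →₀ ℕ) (r : ℂ) :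
    iteratedPartial m (weightedRoot γ β c₁ t r) 0 =
      (∏ j ∈ Finset.range (∑ i, m i), ((r + ∑ i, γ i * m i) / β - (j + 1))) *
        Complex.exp ((r + ∑ i, γ i * m i) * t 0) / (β * c₁ ^ (∑ i, m i + 1)) := by
  induction m using Finsupp.induction_add_single_one generalizing r with
  | zero => simp [iteratedPartial_zero, weightedRoot, rootDenom]
  | add_single m i ih =>
    have hT := isSmoothOperator_iteratedPartial hV m
    have hw := contDiffOn_weightedRoot (γ := γ) (β := β) (c₁ := c₁) ht hq
    have hterm : ∀ j, ContDiffOn ℂ ∞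
        (fun c => c j * partialDeriv j (weightedRoot γ β c₁ t (r + γ i)) c) V := fun j =>
      (contDiffOn_coord j).mul ((hw _).partialDeriv hV j)
    rw [iteratedPartial_add_single hV (hw r) m i h0,
      hT.congr (partialDeriv_weightedRoot hV ht hroot hq hβ hc₁ i r) h0,
      hT.add (contDiffOn_const.mul (hw _))
        (ContDiffOn.sum fun j _ => contDiffOn_const.mul (hterm j)) h0]
    simp only
    rw [hT.const_mul _ (hw _) h0,
      iteratedPartial_sum hV _ (fun j => contDiffOn_const.mul (hterm j)) m h0]
    simp only
    have hterm' : ∀ j, iteratedPartial m (fun c => (γ j / β - 1) / c₁ *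
        (c j * partialDeriv j (weightedRoot γ β c₁ t (r + γ i)) c)) 0 =
        (γ j / β - 1) / c₁ * (m j * iteratedPartial m (weightedRoot γ β c₁ t (r + γ i)) 0) := by
      intro j
      rw [hT.const_mul _ (hterm j) h0]
      simp only
      rw [iteratedPartial_coord_mul_partialDeriv hV h0 j m (hw _)]
    have hcard : ∑ k, (m + Finsupp.single i 1 : σ →₀ ℕ) k = ∑ k, m k + 1 := by
      simp [Finset.sum_add_distrib, Finsupp.single_apply]
    have hweight : r + ∑ k, γ k * ((m + Finsupp.single i 1 : σ →₀ ℕ) k : ℂ) =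
        r + γ i + ∑ k, γ k * (m k : ℂ) := by
      simp [mul_add, Finset.sum_add_distrib, Finsupp.single_apply, add_comm, add_assoc]
    simp only [hterm', hcard, hweight]
    set W := iteratedPartial m (weightedRoot γ β c₁ t (r + γ i)) 0 with hW
    have hsum : ∑ j, (γ j / β - 1) / c₁ * (m j * W) =
        ((∑ j, γ j * (m j : ℂ)) / β - (∑ j, m j : ℕ)) / c₁ * W := by
      push_cast
      rw [Finset.sum_div, ← Finset.sum_sub_distrib, Finset.sum_div, Finset.sum_mul]
      exact Finset.sum_congr rfl fun j _ => by ring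
    rw [hsum, hW, ih, Finset.prod_range_succ]
    field_simp
    ring

/-- The Taylor coefficients of a power `e ^ (s t)` of a root `e ^ t`. -/
theorem iteratedPartial_exp_root (hV : IsOpen V) (h0 : (0 : σ → ℂ) ∈ V)
    (ht : ContDiffOn ℂ ∞ t V)
    (hroot : ∀ c ∈ V, c₁ + c₂ * Complex.exp (β * t c) + ∑ j, c j * Complex.exp (γ j * t c) = 0)
    (hβ : β ≠ 0) (hc₁ : c₁ ≠ 0) {m : σ →₀ ℕ} (hm : m ≠ 0) (s : ℂ) :
    iteratedPartial m (fun c => Complex.exp (s * t c)) 0 =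
      s * (∏ j ∈ Finset.range (∑ i, m i - 1), ((s + ∑ i, γ i * m i) / β - (j + 1))) *
        Complex.exp ((s + ∑ i, γ i * m i) * t 0) / (β * c₁ ^ (∑ i, m i)) := by
  -- Shrink the neighbourhood so that the denominator, which is `β c₁` at `0`, has no zero.
  obtain ⟨W, hW, h0W, hWV, hq⟩ : ∃ W : Set (σ → ℂ), IsOpen W ∧ 0 ∈ W ∧ W ⊆ V ∧
      ∀ c ∈ W, rootDenom γ β c₁ t c ≠ 0 := by
    refine ⟨V ∩ rootDenom γ β c₁ t ⁻¹' {0}ᶜ,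
      (contDiffOn_rootDenom ht).continuousOn.isOpen_inter_preimage hV isOpen_compl_singleton,
      ⟨h0, ?_⟩, Set.inter_subset_left, fun c hc => hc.2⟩
    simp [rootDenom_zero, hβ, hc₁]
  replace ht := ht.mono hWV
  replace hroot := fun c hc => hroot c (hWV hc)
  obtain ⟨i, hi⟩ := Finsupp.ne_iff.1 hm
  obtain ⟨m, rfl⟩ : ∃ m' : σ →₀ ℕ, m = m' + Finsupp.single i 1 :=
    ⟨m - Finsupp.single i 1, (tsub_add_cancel_of_le
      (Finsupp.single_le_iff.2 (Nat.one_le_iff_ne_zero.2 hi))).symm⟩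
  have hT := isSmoothOperator_iteratedPartial hW m
  have hderiv : Set.EqOn (partialDeriv i (fun c => Complex.exp (s * t c)))
      (fun c => s * weightedRoot γ β c₁ t (s + γ i) c) W := by
    intro c hc
    have hti : HasDerivAt _ _ _ := ht.hasLineDerivAt hW i hc
    have h4 : HasLineDerivAt ℂ (fun c => Complex.exp (s * t c)) _ c (Pi.single i 1) :=
      (hti.const_mul s).cexp
    rw [partialDeriv, h4.lineDeriv, partialDeriv_root hW ht hroot hq i hc]
    simp only [zero_smul, add_zero, weightedRoot, add_mul, Complex.exp_add]
    ring
  have hcard : ∑ k, (m + Finsupp.single i 1 : σ →₀ ℕ) k = ∑ k, m k + 1 := by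
    simp [Finset.sum_add_distrib, Finsupp.single_apply]
  have hweight : s + ∑ k, γ k * ((m + Finsupp.single i 1 : σ →₀ ℕ) k : ℂ) =
      s + γ i + ∑ k, γ k * (m k : ℂ) := by
    simp [mul_add, Finset.sum_add_distrib, Finsupp.single_apply, add_comm, add_assoc]
  rw [iteratedPartial_add_single hW (contDiffOn_const.mul ht).cexp m i h0W, hT.congr hderiv h0W,
    hT.const_mul _ (contDiffOn_weightedRoot ht hq _) h0W]
  simp only
  rw [iteratedPartial_weightedRoot hW h0W ht hroot hq hβ hc₁, hcard, hweight,
    Nat.add_sub_cancel]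
  ring

end Root

/-! ### The coefficients `γ(u, v)` -/

theorem gammaCoeff_zero_right (u : ℚ) : gammaCoeff u 0 = 1 := by simp [gammaCoeff]

theorem gammaCoeff_neg (u : ℚ) (k : ℕ) :
    gammaCoeff u (-(k : ℤ)) = ∏ i ∈ Finset.range k, (u - i) := by
  rcases Nat.eq_zero_or_pos k with rfl | hk
  · simp [gammaCoeff]
  · rw [gammaCoeff, if_neg (by omega), if_pos (by omega), Int.natAbs_neg, Int.natAbs_natCast,
      Finset.prod_bij' (s := Finset.Icc 1 k) (t := Finset.range k) (fun i _ => i - 1)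
        (fun i _ => i + 1)] <;> simp
    · omega
    · omega
    · intro i h1 h2
      rw [Nat.cast_sub h1]; push_cast; ring

/-- Away from the exceptional case of a negative integer `u ≥ -v`, the value of `γ(u, v)`
for `v ≥ 0`. -/
theorem gammaCoeff_natCast {u : ℚ} {k : ℕ} (hu : ∀ w : ℤ, u = w → u < 0 → u < -(k : ℚ)) :
    gammaCoeff u k = (∏ i ∈ Finset.range k, (u + (i + 1)))⁻¹ := by
  rcases Nat.eq_zero_or_pos k with rfl | hk
  · simp [gammaCoeff]
  · rw [gammaCoeff, if_neg (by omega), if_neg (by omega), if_neg, Int.natAbs_natCast, one_div,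
      Finset.prod_bij' (s := Finset.Icc 1 k) (t := Finset.range k) (fun i _ => i - 1)
        (fun i _ => i + 1)]
    any_goals simp
    · omega
    · omega
    · intro i h1 h2
      rw [Nat.cast_sub h1]; push_cast; ring
    · intro w hw h0
      have := hu w hw h0
      simpa using this

/-- The functional equation `(u + v)! = (u + v) (u + v - 1)!` for `γ(u, v) = u! / (u + v)!`. -/
theorem gammaCoeff_sub_one {u : ℚ} {v : ℤ} (h : ∀ w : ℤ, u = w → u < 0 → v ≤ 0) :
    gammaCoeff u (v - 1) = (u + v) * gammaCoeff u v := by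
  rcases le_or_gt v 0 with hv | hv
  · obtain ⟨k, rfl⟩ : ∃ k : ℕ, v = -k := ⟨v.natAbs, by omega⟩
    rw [show -(k : ℤ) - 1 = -((k + 1 : ℕ) : ℤ) by push_cast; ring, gammaCoeff_neg, gammaCoeff_neg,
      Finset.prod_range_succ]
    push_cast; ring
  · obtain ⟨k, rfl⟩ : ∃ k : ℕ, v = (k + 1 : ℕ) := ⟨(v - 1).natAbs, by omega⟩
    have hu : ∀ w : ℤ, u = w → ¬ u < 0 := fun w hw h0 => absurd (h w hw h0) (by omega)
    rw [show ((k + 1 : ℕ) : ℤ) - 1 = (k : ℤ) by push_cast; ring,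
      gammaCoeff_natCast fun w hw h0 => absurd h0 (hu w hw),
      gammaCoeff_natCast fun w hw h0 => absurd h0 (hu w hw), Finset.prod_range_succ, mul_inv]
    have hne : u + (k + 1) ≠ 0 := fun h0 => by
      refine hu (-(k + 1)) (by push_cast; linarith) ?_
      have : (0 : ℚ) ≤ k := by positivity
      linarith
    push_cast
    field_simp

/-- The identity `u! = u (u - 1)!` for `γ(u, v) = u! / (u + v)!`. -/
theorem gammaCoeff_eq_mul {u : ℚ} (h : ∀ w : ℤ, u = w → 0 < u) (v : ℤ) :
    gammaCoeff u v = u * gammaCoeff (u - 1) (v + 1) := by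
  have hu0 : u ≠ 0 := fun h0 => (h 0 (by simpa using h0)).ne' h0
  have h1 : ∀ w : ℤ, u - 1 = w → ¬ u - 1 < 0 := fun w hw h0 => by
    have h2 := h (w + 1) (by push_cast; linarith)
    rw [hw] at h0
    have h3 : w < 0 := by exact_mod_cast h0
    have h4 : u = ((w + 1 : ℤ) : ℚ) := by push_cast; linarith
    rw [h4] at h2
    have h5 : 0 < w + 1 := by exact_mod_cast h2
    omega
  induction v using Int.induction_on with
  | zero =>
    have := gammaCoeff_sub_one (u := u - 1) (v := 1) fun w hw h0 => absurd h0 (h1 w hw)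
    simpa [gammaCoeff_zero_right] using this
  | succ i ih =>
    have e1 := gammaCoeff_sub_one (u := u) (v := i + 1)
      fun w hw h0 => absurd h0 (not_lt.2 (h w hw).le)
    have e2 := gammaCoeff_sub_one (u := u - 1) (v := i + 1 + 1)
      fun w hw h0 => absurd h0 (h1 w hw)
    have hne : u + ((i + 1 : ℤ) : ℚ) ≠ 0 := fun h0 => by
      have := h (-(i + 1)) (by push_cast at h0 ⊢; linarith)
      have h3 : (0 : ℚ) ≤ i := by positivity
      push_cast at h0
      linarith
    simp only [add_sub_cancel_right] at e1 e2
    apply mul_left_cancel₀ hne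
    rw [← e1, ih, e2]
    push_cast; ring
  | pred i ih =>
    rw [gammaCoeff_sub_one fun w hw h0 => absurd h0 (not_lt.2 (h w hw).le), ih]
    have e2 := gammaCoeff_sub_one (u := u - 1) (v := -i + 1)
      fun w hw h0 => absurd h0 (h1 w hw)
    rw [show (-(i : ℤ)) - 1 + 1 = -i + 1 - 1 by ring, e2]
    push_cast; ring

/-- Negative powers of a variable with starting exponent `a ∈ ℕ` do not occur. -/
theorem gammaCoeff_nat_of_add_neg {a : ℕ} {v : ℤ} (h : (a : ℤ) + v < 0) :
    gammaCoeff a v = 0 := by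
  obtain ⟨k, rfl⟩ : ∃ k : ℕ, v = -k := ⟨v.natAbs, by omega⟩
  rw [gammaCoeff_neg]
  exact Finset.prod_eq_zero (i := a) (by simp; omega) (by simp)

theorem gammaCoeff_neg_one_of_pos {v : ℤ} (h : 0 < v) : gammaCoeff (-1) v = 0 := by
  rw [gammaCoeff, if_neg (by omega), if_neg (by omega), if_pos]
  refine ⟨⟨-1, by simp⟩, by norm_num, ?_⟩
  have : (1 : ℚ) ≤ v := by exact_mod_cast h
  linarith

theorem gammaCoeff_zero_left (m : ℕ) : gammaCoeff 0 m = (m.factorial : ℚ)⁻¹ := by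
  rw [gammaCoeff_natCast fun w _ h => absurd h (lt_irrefl _),
    ← Finset.prod_range_add_one_eq_factorial]
  simp [-Finset.prod_range_add_one_eq_factorial]

theorem gammaCoeff_one_left (m : ℕ) : gammaCoeff 1 ((m : ℤ) - 1) = (m.factorial : ℚ)⁻¹ := by
  rw [gammaCoeff_eq_mul fun _ _ => one_pos]
  simpa using gammaCoeff_zero_left m

/-- The value `γ(a, m - a) = 1 / m!` for an exponent `a ∈ {0, 1}`. -/
theorem gammaCoeff_nat_sub {a : ℕ} (ha : a ≤ 1) (m : ℕ) :
    gammaCoeff a ((m : ℤ) - a) = (m.factorial : ℚ)⁻¹ := by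
  interval_cases a
  · simpa using gammaCoeff_zero_left m
  · simpa using gammaCoeff_one_left m

/-- Lowering `v` by `k` produces a falling product, by iteration of the functional equation. -/
theorem gammaCoeff_sub_natCast {u : ℚ} {v : ℤ} (h : ∀ w : ℤ, u = w → u < 0 → v ≤ 0) (k : ℕ) :
    gammaCoeff u (v - k) = (∏ j ∈ Finset.range k, (u + 1 + v - (j + 1))) * gammaCoeff u v := by
  induction k with
  | zero => simp
  | succ k ih =>
    rw [Nat.cast_succ, ← sub_sub, gammaCoeff_sub_one fun w hw h0 => by have := h w hw h0; omega,
      ih, Finset.prod_range_succ]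
    push_cast; ring

/-- A form of the reflection formula `Γ(u) Γ(1 - u) = π / sin (π u)`. -/
theorem gammaCoeff_reflection {u : ℚ} (h : ∀ w : ℤ, u ≠ w) (N : ℤ) :
    gammaCoeff (u - 1) N * gammaCoeff (-u) (-N) = (-1) ^ N := by
  have h1 : ∀ w : ℤ, u - 1 ≠ w := fun w hw => h (w + 1) (by push_cast; linarith)
  have h2 : ∀ w : ℤ, -u ≠ w := fun w hw => h (-w) (by push_cast; linarith)
  have step : ∀ N : ℤ, gammaCoeff (u - 1) (N + 1) * gammaCoeff (-u) (-(N + 1)) =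
      - (gammaCoeff (u - 1) N * gammaCoeff (-u) (-N)) := by
    intro N
    have e1 := gammaCoeff_sub_one (u := u - 1) (v := N + 1) fun w hw => absurd hw (h1 w)
    have e2 := gammaCoeff_sub_one (u := -u) (v := -N) fun w hw => absurd hw (h2 w)
    rw [add_sub_cancel_right] at e1
    rw [show -(N + 1) = -N - 1 by ring, e2, e1]
    push_cast; ring
  induction N using Int.induction_on with
  | zero => simp [gammaCoeff_zero_right]
  | succ i ih => rw [step, ih, zpow_add₀ (by norm_num)]; simp
  | pred i ih =>
    have := step (-i - 1)
    rw [sub_add_cancel, ih] at this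
    rw [← neg_eq_iff_eq_neg.2 this, zpow_sub₀ (by norm_num)]; simp [div_neg]

/-- The reflection formula at `u = 1`. -/
theorem gammaCoeff_zero_mul_neg_one (M : ℕ) :
    gammaCoeff 0 M * gammaCoeff (-1) (-(M : ℤ)) = (-1) ^ M := by
  rw [gammaCoeff_zero_left, gammaCoeff_neg]
  have : ∏ i ∈ Finset.range M, ((-1 : ℚ) - i) = (-1) ^ M * M.factorial := by
    rw [← Finset.prod_range_add_one_eq_factorial, Nat.cast_prod, ← Finset.card_range M,
      ← Finset.prod_const, Finset.card_range, ← Finset.prod_mul_distrib]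
    exact Finset.prod_congr rfl fun i _ => by push_cast; ring
  rw [this]
  have := Nat.factorial_ne_zero M
  field_simp

/-! ### Bracket series with two distinguished indices -/

section Bracket

variable {n : ℕ} {i₁ i₂ : Fin (n + 1)}

@[to_additive]
theorem Fin.prod_eq_mul_prod_otherIndex {M : Type*} [CommMonoid M] (hi : i₁ ≠ i₂)
    (f : Fin (n + 1) → M) : ∏ i, f i = f i₁ * f i₂ * ∏ j : OtherIndex i₁ i₂, f j := by
  rw [← Fintype.prod_subtype_mul_prod_subtype (fun i => i ≠ i₁ ∧ i ≠ i₂) f, mul_comm]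
  congr 1
  rw [← Finset.prod_pair hi]
  refine (Finset.prod_subtype _ (fun i => ?_) f).symm
  simp only [Finset.mem_insert, Finset.mem_singleton]
  tauto

theorem mem_kernelLattice {v : Fin (n + 1) → ℤ} :
    v ∈ kernelLattice n ↔ ∑ i, (v i : ℚ) = 0 ∧ ∑ i : Fin (n + 1), ((i : ℕ) : ℚ) * v i = 0 := by
  simp [kernelLattice, hyperMatrix, funext_iff, Fin.forall_fin_two, dotProduct, and_comm]

theorem bracketSeries_add {u : Fin (n + 1) → ℚ} {v : Fin (n + 1) → ℤ} (hv : v ∈ kernelLattice n) :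
    bracketSeries u (fun i => u i + v i) = ((∏ i, gammaCoeff (u i) (v i) : ℚ) : ℂ) := by
  rw [bracketSeries, finsum_eq_single _ v]
  · simp [hv]
  · intro w hw
    have hne : ¬ (fun i => u i + (w i : ℚ)) = fun i => u i + (v i : ℚ) := fun h => hw <| by
      funext i
      simpa using congrFun h i
    simp [hne]

theorem exists_of_bracketSeries_ne_zero {u e : Fin (n + 1) → ℚ} (h : bracketSeries u e ≠ 0) :
    ∃ v ∈ kernelLattice n, e = fun i => u i + (v i : ℚ) := by
  rw [bracketSeries] at h
  obtain ⟨v, hv, hne⟩ := exists_ne_zero_of_finsum_mem_ne_zero h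
  refine ⟨v, hv, ?_⟩
  by_contra hcon
  exact hne (if_neg (Ne.symm hcon))

theorem mixedExp_left {d : ℕ} {m : OtherIndex i₁ i₂ →₀ ℕ} {p q : ℤ} :
    mixedExp i₁ i₂ d m p q i₁ = p / d := by simp [mixedExp]

theorem mixedExp_right (hi : i₁ ≠ i₂) {d : ℕ} {m : OtherIndex i₁ i₂ →₀ ℕ} {p q : ℤ} :
    mixedExp i₁ i₂ d m p q i₂ = q / d := by simp [mixedExp, hi.symm]

theorem mixedExp_other {d : ℕ} {m : OtherIndex i₁ i₂ →₀ ℕ} {p q : ℤ} (j : OtherIndex i₁ i₂) :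
    mixedExp i₁ i₂ d m p q j = m j := by simp [mixedExp, j.2]

/-- The weight `1 + ∑ i, (i - i₁) (m i)` of a multi-index. -/
def rootWeight (i₁ i₂ : Fin (n + 1)) (m : OtherIndex i₁ i₂ →₀ ℕ) : ℤ :=
  1 + ∑ j : OtherIndex i₁ i₂, (((j.1 : ℕ) : ℤ) - (i₁ : ℕ)) * m j

/-- Exponent vectors `u` such as those of the brackets in Sturmfels' series: `A u` is the
column `(-1, 0)`, the entries at `i₁`, `i₂` lie in `ℤ / d`, the others in `{0, 1}`. -/
structure IsStartExponent (i₁ i₂ : Fin (n + 1)) (d : ℕ) (u : Fin (n + 1) → ℚ) : Prop where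
  left : ∃ p : ℤ, u i₁ = p / d
  right : ∃ q : ℤ, u i₂ = q / d
  other : ∀ j : OtherIndex i₁ i₂, ∃ a : ℕ, a ≤ 1 ∧ u j = a
  sum : ∑ i, u i = 0
  sum_mul : ∑ i : Fin (n + 1), ((i : ℕ) : ℚ) * u i = -1

theorem sum_mixedExp (hi : i₁ ≠ i₂) {d : ℕ} (m : OtherIndex i₁ i₂ →₀ ℕ) (p q : ℤ) :
    ∑ i, mixedExp i₁ i₂ d m p q i = p / d + q / d + ∑ j, (m j : ℚ) := by
  rw [Fin.sum_eq_add_sum_otherIndex hi, mixedExp_left, mixedExp_right hi]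
  simp only [mixedExp_other]

theorem sum_mul_mixedExp (hi : i₁ ≠ i₂) {d : ℕ} (m : OtherIndex i₁ i₂ →₀ ℕ) (p q : ℤ) :
    ∑ i : Fin (n + 1), ((i : ℕ) : ℚ) * mixedExp i₁ i₂ d m p q i =
      (i₁ : ℕ) * (p / d) + (i₂ : ℕ) * (q / d) + (i₁ : ℕ) * ∑ j, (m j : ℚ)
        + (rootWeight i₁ i₂ m - 1) := by
  rw [Fin.sum_eq_add_sum_otherIndex hi, mixedExp_left, mixedExp_right hi]
  simp only [mixedExp_other, rootWeight]
  push_cast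
  simp only [sub_mul, Finset.sum_sub_distrib, Finset.mul_sum]
  ring

/-- The two linear conditions on the exponents determine those at `i₁` and `i₂`. -/
theorem mixedExp_weight_iff (hi : i₁ < i₂) {d : ℕ} (hd : d = (i₂ : ℕ) - (i₁ : ℕ))
    (m : OtherIndex i₁ i₂ →₀ ℕ) (p q : ℤ) :
    (∑ i, mixedExp i₁ i₂ d m p q i = 0 ∧
      ∑ i : Fin (n + 1), ((i : ℕ) : ℚ) * mixedExp i₁ i₂ d m p q i = -1) ↔
    p = rootWeight i₁ i₂ m - d * ∑ j, (m j : ℤ) ∧ q = -rootWeight i₁ i₂ m := by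
  have hi' : (i₁ : ℕ) < i₂ := hi
  have hd0 : (d : ℚ) ≠ 0 := by
    rw [Nat.cast_ne_zero]; omega
  have hi2 : ((i₂ : ℕ) : ℚ) = (i₁ : ℕ) + d := by
    rw [hd, Nat.cast_sub hi'.le]; ring
  rw [sum_mixedExp hi.ne, sum_mul_mixedExp hi.ne, hi2,
    ← Int.cast_inj (α := ℚ) (m := p), ← Int.cast_inj (α := ℚ) (m := q)]
  push_cast
  constructor
  · rintro ⟨h1, h2⟩
    have hq : (q : ℚ) = -rootWeight i₁ i₂ m := by
      field_simp at h1 h2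
      apply mul_left_cancel₀ hd0
      linear_combination h2 - (i₁ : ℕ) * h1
    refine ⟨?_, hq⟩
    field_simp at h1
    linear_combination h1 - hq
  · rintro ⟨h1, h2⟩
    rw [h1, h2]
    constructor <;> field_simp <;> ring

/-- A bracket series with such a starting exponent is a power series in the other variables,
and in each degree a single monomial in the two distinguished ones. -/
theorem IsStartExponent.exists_of_ne_zero (hi : i₁ < i₂) {d : ℕ} (hd : d = (i₂ : ℕ) - (i₁ : ℕ))
    {u e : Fin (n + 1) → ℚ} (hu : IsStartExponent i₁ i₂ d u) (h : bracketSeries u e ≠ 0) :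
    ∃ m : OtherIndex i₁ i₂ →₀ ℕ, e = mixedExp i₁ i₂ d m
      (rootWeight i₁ i₂ m - d * ∑ j, (m j : ℤ)) (-rootWeight i₁ i₂ m) := by
  obtain ⟨v, hv, rfl⟩ := exists_of_bracketSeries_ne_zero h
  rw [bracketSeries_add hv, Rat.cast_ne_zero, Finset.prod_ne_zero_iff] at h
  have hi' : (i₁ : ℕ) < i₂ := hi
  have hd0 : (d : ℚ) ≠ 0 := by
    rw [Nat.cast_ne_zero]; omega
  obtain ⟨p, hp⟩ := hu.left
  obtain ⟨q, hq⟩ := hu.right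
  choose a _ ha using hu.other
  have hnonneg : ∀ j : OtherIndex i₁ i₂, 0 ≤ (a j : ℤ) + v j := fun j => by
    by_contra hlt
    refine h j (Finset.mem_univ _) ?_
    rw [ha]
    exact gammaCoeff_nat_of_add_neg (not_le.1 hlt)
  set m : OtherIndex i₁ i₂ →₀ ℕ :=
    Finsupp.equivFunOnFinite.symm fun j => ((a j : ℤ) + v j).toNat with hm
  have hmj : ∀ j, ((m j : ℕ) : ℚ) = u j + v j := fun j => by
    have : ((m j : ℕ) : ℤ) = a j + v j := by simp [hm, Int.toNat_of_nonneg (hnonneg j)]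
    rw [ha, ← Int.cast_natCast, this]
    push_cast; rfl
  have he : (fun i => u i + (v i : ℚ)) =
      mixedExp i₁ i₂ d m (p + d * v i₁) (q + d * v i₂) := by
    funext i
    by_cases h1 : i = i₁
    · rw [h1, mixedExp_left, hp]; push_cast; field_simp
    by_cases h2 : i = i₂
    · rw [h2, mixedExp_right hi.ne, hq]; push_cast; field_simp
    exact ((mixedExp_other ⟨i, h1, h2⟩).trans (hmj ⟨i, h1, h2⟩)).symm
  rw [mem_kernelLattice] at hv
  have hw := (mixedExp_weight_iff hi hd m (p + d * v i₁) (q + d * v i₂)).1 (by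
    rw [← he]
    simp only [mul_add, Finset.sum_add_distrib, hu.sum, hu.sum_mul, hv.1, hv.2]
    simp)
  exact ⟨m, by rw [he, hw.1, hw.2]⟩

theorem IsStartExponent.bracketSeries_eq (hi : i₁ < i₂) {d : ℕ} (hd : d = (i₂ : ℕ) - (i₁ : ℕ))
    {u : Fin (n + 1) → ℚ} (hu : IsStartExponent i₁ i₂ d u)
    (m : OtherIndex i₁ i₂ →₀ ℕ) (v₁ v₂ : ℤ)
    (h₁ : u i₁ + v₁ = rootWeight i₁ i₂ m / d - ∑ j, (m j : ℚ))
    (h₂ : u i₂ + v₂ = -rootWeight i₁ i₂ m / d) :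
    bracketSeries u (mixedExp i₁ i₂ d m
      (rootWeight i₁ i₂ m - d * ∑ j, (m j : ℤ)) (-rootWeight i₁ i₂ m)) =
    ((gammaCoeff (u i₁) v₁ * gammaCoeff (u i₂) v₂ * (∏ j, ((m j).factorial : ℚ))⁻¹ : ℚ) : ℂ) := by
  have hi' : (i₁ : ℕ) < i₂ := hi
  have hd0 : (d : ℚ) ≠ 0 := by
    rw [Nat.cast_ne_zero]; omega
  choose a ha1 ha using hu.other
  set e := mixedExp i₁ i₂ d m (rootWeight i₁ i₂ m - d * ∑ j, (m j : ℤ)) (-rootWeight i₁ i₂ m)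
    with he
  set v : Fin (n + 1) → ℤ := fun i =>
    if h : i ≠ i₁ ∧ i ≠ i₂ then (m ⟨i, h⟩ : ℤ) - a ⟨i, h⟩ else if i = i₁ then v₁ else v₂ with hv
  have hv1 : v i₁ = v₁ := by simp [hv]
  have hv2 : v i₂ = v₂ := by simp [hv, hi.ne']
  have hvj : ∀ j : OtherIndex i₁ i₂, v j = (m j : ℤ) - a j := fun j => by simp [hv, j.2]
  have hev : e = fun i => u i + (v i : ℚ) := by
    funext i
    by_cases h1 : i = i₁
    · rw [h1, he, mixedExp_left, hv1, h₁]; push_cast; field_simp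
    by_cases h2 : i = i₂
    · rw [h2, he, mixedExp_right hi.ne, hv2, h₂]; push_cast; rfl
    have := hvj ⟨i, h1, h2⟩
    refine (mixedExp_other ⟨i, h1, h2⟩).trans ?_
    simp only at this
    rw [this, ha ⟨i, h1, h2⟩]
    push_cast; ring
  have hsums := (mixedExp_weight_iff hi hd m _ _).2 ⟨rfl, rfl⟩
  rw [← he, hev] at hsums
  simp only [mul_add, Finset.sum_add_distrib, hu.sum, hu.sum_mul] at hsums
  have hmem : v ∈ kernelLattice n :=
    mem_kernelLattice.2 ⟨by simpa using hsums.1, by simpa using hsums.2⟩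
  rw [hev, bracketSeries_add hmem, Fin.prod_eq_mul_prod_otherIndex hi.ne, hv1, hv2,
    ← Finset.prod_inv_distrib]
  congr 2
  exact Finset.prod_congr rfl fun j _ => by rw [hvj, ha, gammaCoeff_nat_sub (ha1 j)]

theorem bracketSeries_mixedExp_eq_zero (hi : i₁ ≠ i₂) {d : ℕ} {u : Fin (n + 1) → ℚ}
    (m : OtherIndex i₁ i₂ →₀ ℕ) (p q : ℤ) (h : ∀ v : ℤ, u i₂ + v ≠ q / d) :
    bracketSeries u (mixedExp i₁ i₂ d m p q) = 0 := by
  by_contra hne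
  obtain ⟨v, -, hv⟩ := exists_of_bracketSeries_ne_zero hne
  refine h (v i₂) ?_
  rw [← mixedExp_right hi, hv]

end Bracket

/-! ### The coefficients of Sturmfels' series -/

section Sturmfels

variable {n : ℕ} {i₁ i₂ : Fin (n + 1)} {d : ℕ}

theorem sum_mul_monoExp {j : ℕ} (hj : j ≤ n) (q : ℚ) (f : ℕ → ℚ) :
    ∑ i : Fin (n + 1), f i * monoExp n j q i = f j * q := by
  rw [Finset.sum_eq_single ⟨j, by omega⟩]
  · simp [monoExp]
  · intro i _ h
    have hne : (i : ℕ) ≠ j := fun h' => h (Fin.ext h')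
    simp [monoExp, hne]
  · simp

theorem sum_monoExp {j : ℕ} (hj : j ≤ n) (q : ℚ) :
    ∑ i : Fin (n + 1), monoExp n j q i = q := by
  simpa using sum_mul_monoExp hj q fun _ => 1

theorem isStartExponent_first (hi : i₁ < i₂) (hd : d = (i₂ : ℕ) - (i₁ : ℕ)) :
    IsStartExponent i₁ i₂ d (monoExp n i₁ (1 / (d : ℚ)) + monoExp n i₂ (-1 / (d : ℚ))) := by
  have hi' : (i₁ : ℕ) < i₂ := hi
  have hd0 : (d : ℚ) ≠ 0 := by rw [Nat.cast_ne_zero]; omega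
  have hi2 : ((i₂ : ℕ) : ℚ) = (i₁ : ℕ) + d := by rw [hd, Nat.cast_sub hi'.le]; ring
  refine ⟨⟨1, ?_⟩, ⟨-1, ?_⟩, fun j => ⟨0, zero_le_one, ?_⟩, ?_, ?_⟩
  · simp [monoExp, hi'.ne]
  · simp [monoExp, hi'.ne']
  · simp [monoExp, Fin.val_inj, j.2]
  · simp only [Pi.add_apply, Finset.sum_add_distrib]
    rw [sum_monoExp (by omega), sum_monoExp (by omega)]
    ring
  · simp only [Pi.add_apply, mul_add, Finset.sum_add_distrib]
    rw [sum_mul_monoExp (by omega) _ (fun i => (i : ℚ)),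
      sum_mul_monoExp (by omega) _ (fun i => (i : ℚ)), hi2]
    field_simp
    ring

theorem isStartExponent_middle (hi : i₁ < i₂) (hd : d = (i₂ : ℕ) - (i₁ : ℕ)) {k : ℕ} (hk : 2 ≤ k)
    (hkd : k ≤ d) :
    IsStartExponent i₁ i₂ d (monoExp n i₁ (((k : ℚ) - (d : ℚ)) / (d : ℚ))
      + monoExp n (i₁ + k - 1) 1 + monoExp n i₂ (-(k : ℚ) / (d : ℚ))) := by
  have hi' : (i₁ : ℕ) < i₂ := hi
  have hd0 : (d : ℚ) ≠ 0 := by rw [Nat.cast_ne_zero]; omega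
  have hi2 : ((i₂ : ℕ) : ℚ) = (i₁ : ℕ) + d := by rw [hd, Nat.cast_sub hi'.le]; ring
  refine ⟨⟨k - d, ?_⟩, ⟨-k, ?_⟩, fun j => ?_, ?_, ?_⟩
  · simp [monoExp, hi'.ne, show ¬ (i₁ : ℕ) = i₁ + k - 1 by omega]
  · simp [monoExp, hi'.ne', show ¬ (i₂ : ℕ) = i₁ + k - 1 by omega]
  · refine ⟨if (j.1 : ℕ) = i₁ + k - 1 then 1 else 0, by split_ifs <;> simp, ?_⟩
    simp [monoExp, Fin.val_inj, j.2]
  · simp only [Pi.add_apply, Finset.sum_add_distrib]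
    rw [sum_monoExp (by omega), sum_monoExp (by omega), sum_monoExp (by omega)]
    field_simp
    ring
  · simp only [Pi.add_apply, mul_add, Finset.sum_add_distrib]
    rw [sum_mul_monoExp (by omega) _ (fun i => (i : ℚ)),
      sum_mul_monoExp (by omega) _ (fun i => (i : ℚ)),
      sum_mul_monoExp (by omega) _ (fun i => (i : ℚ)), hi2, Nat.cast_sub (by omega)]
    push_cast
    field_simp
    ring

theorem isStartExponent_last (hi : i₁ < i₂) (hd : d ≠ 0) (h0 : (i₁ : ℕ) ≠ 0) :
    IsStartExponent i₁ i₂ d (monoExp n (i₁ - 1) 1 + monoExp n i₁ (-1)) := by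
  have hi' : (i₁ : ℕ) < i₂ := hi
  have hd0 : (d : ℚ) ≠ 0 := Nat.cast_ne_zero.2 hd
  refine ⟨⟨-d, ?_⟩, ⟨0, ?_⟩, fun j => ?_, ?_, ?_⟩
  · simp [monoExp, show ¬ (i₁ : ℕ) = i₁ - 1 by omega, hd0]
  · simp [monoExp, hi'.ne', show ¬ (i₂ : ℕ) = i₁ - 1 by omega]
  · refine ⟨if (j.1 : ℕ) = i₁ - 1 then 1 else 0, by split_ifs <;> simp, ?_⟩
    simp [monoExp, Fin.val_inj, j.2]
  · simp only [Pi.add_apply, Finset.sum_add_distrib]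
    rw [sum_monoExp (by omega), sum_monoExp (by omega)]
    ring
  · simp only [Pi.add_apply, mul_add, Finset.sum_add_distrib]
    rw [sum_mul_monoExp (by omega) _ (fun i => (i : ℚ)),
      sum_mul_monoExp (by omega) _ (fun i => (i : ℚ)), Nat.cast_sub (by omega)]
    push_cast
    ring

theorem sturmfelsSeries_apply (ξ : ℂ) (e : Fin (n + 1) → ℚ) (hd : d = (i₂ : ℕ) - (i₁ : ℕ)) :
    sturmfelsSeries n i₁ i₂ ξ e =
      ξ * bracketSeries (monoExp n i₁ (1 / (d : ℚ)) + monoExp n i₂ (-1 / (d : ℚ))) e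
      + (1 / (d : ℂ)) * ∑ k ∈ Finset.Icc 2 d, ξ ^ k *
          bracketSeries (monoExp n i₁ (((k : ℚ) - (d : ℚ)) / (d : ℚ)) + monoExp n (i₁ + k - 1) 1
            + monoExp n i₂ (-(k : ℚ) / (d : ℚ))) e
      + (1 / (d : ℂ)) * (if (i₁ : ℕ) = 0 then 0
          else bracketSeries (monoExp n (i₁ - 1) 1 + monoExp n i₁ (-1)) e) := by
  subst hd
  simp only [sturmfelsSeries, Pi.add_apply, Pi.smul_apply, Finset.sum_apply, smul_eq_mul]
  split_ifs <;> rfl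

/-- The exponent vector of the only monomial of Sturmfels' series that has multi-index `m` in
the variables other than `a_{i₁}`, `a_{i₂}`. -/
def soleExp (i₁ i₂ : Fin (n + 1)) (d : ℕ) (m : OtherIndex i₁ i₂ →₀ ℕ) : Fin (n + 1) → ℚ :=
  mixedExp i₁ i₂ d m (rootWeight i₁ i₂ m - d * ∑ j, (m j : ℤ)) (-rootWeight i₁ i₂ m)

theorem exists_eq_soleExp (hi : i₁ < i₂) (hd : d = (i₂ : ℕ) - (i₁ : ℕ)) (ξ : ℂ)
    {e : Fin (n + 1) → ℚ} (he : sturmfelsSeries n i₁ i₂ ξ e ≠ 0) :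
    ∃ m, e = soleExp i₁ i₂ d m := by
  have hd0 : d ≠ 0 := by
    have hi' : (i₁ : ℕ) < i₂ := hi
    omega
  by_contra hcon
  have hzero : ∀ u, IsStartExponent i₁ i₂ d u → bracketSeries u e = 0 := fun u hu => by
    by_contra h
    exact hcon (hu.exists_of_ne_zero hi hd h)
  refine he ?_
  rw [sturmfelsSeries_apply ξ e hd, hzero _ (isStartExponent_first hi hd),
    Finset.sum_eq_zero fun k hk => ?_]
  · split_ifs with h0
    · simp
    · simp [hzero _ (isStartExponent_last hi hd0 h0)]
  · rw [Finset.mem_Icc] at hk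
    rw [hzero _ (isStartExponent_middle hi hd hk.1 hk.2), mul_zero]

theorem mixedExp_injective (hi : i₁ ≠ i₂) (hd : d ≠ 0) {m m' : OtherIndex i₁ i₂ →₀ ℕ}
    {p q p' q' : ℤ} (h : mixedExp i₁ i₂ d m p q = mixedExp i₁ i₂ d m' p' q') :
    m = m' ∧ p = p' ∧ q = q' := by
  have hd0 : (d : ℚ) ≠ 0 := Nat.cast_ne_zero.2 hd
  refine ⟨Finsupp.ext fun j => ?_, ?_, ?_⟩
  · have := congrFun h j
    rw [mixedExp_other, mixedExp_other] at this
    exact_mod_cast this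
  · have := congrFun h i₁
    rw [mixedExp_left, mixedExp_left, div_left_inj' hd0] at this
    exact_mod_cast this
  · have := congrFun h i₂
    rw [mixedExp_right hi, mixedExp_right hi, div_left_inj' hd0] at this
    exact_mod_cast this

/-- In multi-index `m`, only one monomial in the distinguished variables occurs. -/
theorem sturmfelsSeries_mixedExp_eq_zero (hi : i₁ < i₂) (hd : d = (i₂ : ℕ) - (i₁ : ℕ)) (ξ : ℂ)
    {m : OtherIndex i₁ i₂ →₀ ℕ} {t : ℤ × ℤ}
    (ht : t ≠ (rootWeight i₁ i₂ m - d * ∑ j, (m j : ℤ), -rootWeight i₁ i₂ m)) :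
    sturmfelsSeries n i₁ i₂ ξ (mixedExp i₁ i₂ d m t.1 t.2) = 0 := by
  have hd0 : d ≠ 0 := by
    have hi' : (i₁ : ℕ) < i₂ := hi
    omega
  by_contra h
  obtain ⟨m', hm'⟩ := exists_eq_soleExp hi hd ξ h
  obtain ⟨rfl, h1, h2⟩ := mixedExp_injective hi.ne hd0 hm'
  exact ht (Prod.ext h1 h2)

theorem isPowerSeriesOutside_sturmfelsSeries (hi : i₁ < i₂) (hd : d = (i₂ : ℕ) - (i₁ : ℕ))
    (ξ : ℂ) : IsPowerSeriesOutside i₁ i₂ d (sturmfelsSeries n i₁ i₂ ξ) := by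
  refine ⟨fun e he => ?_, fun m => ?_⟩
  · obtain ⟨m, rfl⟩ := exists_eq_soleExp hi hd ξ he
    exact ⟨m, _, _, rfl⟩
  · refine (Set.finite_singleton
      (rootWeight i₁ i₂ m - d * ∑ j, (m j : ℤ), -rootWeight i₁ i₂ m)).subset fun t ht => ?_
    by_contra hne
    exact ht (sturmfelsSeries_mixedExp_eq_zero hi hd ξ hne)

theorem specializeSeries_sturmfelsSeries (hi : i₁ < i₂) (hd : d = (i₂ : ℕ) - (i₁ : ℕ))
    (ξ A B : ℂ) (m : OtherIndex i₁ i₂ →₀ ℕ) :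
    specializeSeries i₁ i₂ d A B (sturmfelsSeries n i₁ i₂ ξ) m =
      sturmfelsSeries n i₁ i₂ ξ (soleExp i₁ i₂ d m)
        * A ^ (rootWeight i₁ i₂ m - d * ∑ j, (m j : ℤ)) * B ^ (-rootWeight i₁ i₂ m) := by
  rw [specializeSeries, finsum_eq_single _
    (rootWeight i₁ i₂ m - d * ∑ j, (m j : ℤ), -rootWeight i₁ i₂ m)]
  · rfl
  · intro t ht
    rw [sturmfelsSeries_mixedExp_eq_zero hi hd ξ ht]
    simp

theorem bracketSeries_middle_eq_zero (hi : i₁ < i₂) (hd : d = (i₂ : ℕ) - (i₁ : ℕ)) {k : ℕ}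
    (hk : 2 ≤ k) (hkd : k ≤ d) {m : OtherIndex i₁ i₂ →₀ ℕ}
    (hs : ¬ (d : ℤ) ∣ rootWeight i₁ i₂ m - k) :
    bracketSeries (monoExp n i₁ (((k : ℚ) - (d : ℚ)) / (d : ℚ)) + monoExp n (i₁ + k - 1) 1
      + monoExp n i₂ (-(k : ℚ) / (d : ℚ))) (soleExp i₁ i₂ d m) = 0 := by
  have hi' : (i₁ : ℕ) < i₂ := hi
  have hd0 : (d : ℚ) ≠ 0 := by rw [Nat.cast_ne_zero]; omega
  refine bracketSeries_mixedExp_eq_zero hi.ne _ _ _ fun v hv => hs ⟨-v, ?_⟩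
  simp only [monoExp, Pi.add_apply, hi'.ne', show ¬ (i₂ : ℕ) = i₁ + k - 1 by omega, if_false,
    if_true] at hv
  field_simp at hv
  push_cast at hv
  rw [← Int.cast_inj (α := ℚ)]
  push_cast
  linear_combination hv

theorem bracketSeries_first_eq_zero (hi : i₁ < i₂) (hd : d = (i₂ : ℕ) - (i₁ : ℕ))
    {m : OtherIndex i₁ i₂ →₀ ℕ} (hs : ¬ (d : ℤ) ∣ rootWeight i₁ i₂ m - 1) :
    bracketSeries (monoExp n i₁ (1 / (d : ℚ)) + monoExp n i₂ (-1 / (d : ℚ)))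
      (soleExp i₁ i₂ d m) = 0 := by
  have hi' : (i₁ : ℕ) < i₂ := hi
  have hd0 : (d : ℚ) ≠ 0 := by rw [Nat.cast_ne_zero]; omega
  refine bracketSeries_mixedExp_eq_zero hi.ne _ _ _ fun v hv => hs ⟨-v, ?_⟩
  simp only [monoExp, Pi.add_apply, hi'.ne', if_false, if_true] at hv
  field_simp at hv
  push_cast at hv
  rw [← Int.cast_inj (α := ℚ)]
  push_cast
  linear_combination hv

theorem bracketSeries_last_eq_zero (hi : i₁ < i₂) (hd : d = (i₂ : ℕ) - (i₁ : ℕ))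
    {m : OtherIndex i₁ i₂ →₀ ℕ} (hs : ¬ (d : ℤ) ∣ rootWeight i₁ i₂ m) :
    bracketSeries (monoExp n (i₁ - 1) 1 + monoExp n i₁ (-1)) (soleExp i₁ i₂ d m) = 0 := by
  have hi' : (i₁ : ℕ) < i₂ := hi
  have hd0 : (d : ℚ) ≠ 0 := by rw [Nat.cast_ne_zero]; omega
  refine bracketSeries_mixedExp_eq_zero hi.ne _ _ _ fun v hv => hs ⟨-v, ?_⟩
  simp only [monoExp, Pi.add_apply, hi'.ne', show ¬ (i₂ : ℕ) = i₁ - 1 by omega, if_false] at hv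
  field_simp at hv
  push_cast at hv
  rw [← Int.cast_inj (α := ℚ)]
  push_cast
  linear_combination hv

/-- The coefficient, at the monomial of multi-index `m` and weight `k + d N`, of the bracket of
index `k` in Sturmfels' series; for `k = 1` this bracket would be
`[a_{i₁} ^ (1 / d - 1) a_{i₁} a_{i₂} ^ (-1 / d)]`, with the two powers of `a_{i₁}` kept apart. -/
noncomputable def bracketValue (d k : ℕ) (N : ℤ) (m : OtherIndex i₁ i₂ →₀ ℕ) : ℚ :=
  (∏ j ∈ Finset.range (∑ i, m i - 1), ((k : ℚ) / d + N - (j + 1))) *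
    (gammaCoeff ((k : ℚ) / d - 1) N * gammaCoeff (-((k : ℚ) / d)) (-N))
      * (∏ j, ((m j).factorial : ℚ))⁻¹

theorem gammaCoeff_mul_eq_bracketValue (hd : d ≠ 0) {k : ℕ} (hk : 1 ≤ k) (N : ℤ)
    {m : OtherIndex i₁ i₂ →₀ ℕ} (hm : m ≠ 0) :
    gammaCoeff ((k : ℚ) / d - 1) (N + 1 - ∑ j, (m j : ℤ)) * gammaCoeff (-((k : ℚ) / d)) (-N)
      * (∏ j, ((m j).factorial : ℚ))⁻¹ = bracketValue d k N m := by
  have hM : 1 ≤ ∑ j, m j := by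
    rw [Nat.one_le_iff_ne_zero, Ne, Finset.sum_eq_zero_iff]
    exact fun h => hm (Finsupp.ext fun j => h j (Finset.mem_univ _))
  have hpos : (0 : ℚ) < (k : ℚ) / d := by positivity
  have harg : N + 1 - ∑ j, (m j : ℤ) = N - ((∑ j, m j - 1 : ℕ) : ℤ) := by
    rw [Nat.cast_sub hM]; push_cast; ring
  rw [harg, gammaCoeff_sub_natCast, bracketValue]
  · simp only [sub_add_cancel]
    ring
  · -- `k / d - 1 > -1` is not a negative integer.
    intro w hw h0
    have h1 : (-1 : ℚ) < w := by linarith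
    rw [hw] at h0
    have h2 : -1 < w := by exact_mod_cast h1
    have h3 : w < 0 := by exact_mod_cast h0
    omega

theorem bracketSeries_middle_eq (hi : i₁ < i₂) (hd : d = (i₂ : ℕ) - (i₁ : ℕ)) {k : ℕ}
    (hk : 2 ≤ k) (hkd : k ≤ d) {m : OtherIndex i₁ i₂ →₀ ℕ} (hm : m ≠ 0) {N : ℤ}
    (hs : rootWeight i₁ i₂ m = k + d * N) :
    bracketSeries (monoExp n i₁ (((k : ℚ) - (d : ℚ)) / (d : ℚ)) + monoExp n (i₁ + k - 1) 1
      + monoExp n i₂ (-(k : ℚ) / (d : ℚ))) (soleExp i₁ i₂ d m) = (bracketValue d k N m : ℂ) := by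
  have hi' : (i₁ : ℕ) < i₂ := hi
  have hd' : d ≠ 0 := by omega
  have hd0 : (d : ℚ) ≠ 0 := Nat.cast_ne_zero.2 hd'
  set u := monoExp n i₁ (((k : ℚ) - (d : ℚ)) / (d : ℚ)) + monoExp n (i₁ + k - 1) 1
      + monoExp n i₂ (-(k : ℚ) / (d : ℚ)) with hu
  have hu1 : u i₁ = (k : ℚ) / d - 1 := by
    simp [hu, monoExp, hi'.ne, show ¬ (i₁ : ℕ) = i₁ + k - 1 by omega, sub_div, hd0]
  have hu2 : u i₂ = -((k : ℚ) / d) := by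
    simp [hu, monoExp, hi'.ne', show ¬ (i₂ : ℕ) = i₁ + k - 1 by omega, neg_div]
  rw [soleExp, (isStartExponent_middle hi hd hk hkd).bracketSeries_eq hi hd m
    (N + 1 - ∑ j, (m j : ℤ)) (-N), ← hu, hu1, hu2,
    gammaCoeff_mul_eq_bracketValue hd' (by omega) N hm]
  · rw [← hu, hu1, hs]; push_cast; field_simp; ring
  · rw [← hu, hu2, hs]; push_cast; field_simp; ring

/-- The initial bracket fits the pattern of the others, with `k = 1`, because `u! = u (u - 1)!` for
`u = 1 / d`; this is why its factor is `ξ` rather than `ξ / d`. -/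
theorem bracketSeries_first_eq (hi : i₁ < i₂) (hd : d = (i₂ : ℕ) - (i₁ : ℕ))
    {m : OtherIndex i₁ i₂ →₀ ℕ} (hm : m ≠ 0) {N : ℤ}
    (hs : rootWeight i₁ i₂ m = 1 + d * N) :
    bracketSeries (monoExp n i₁ (1 / (d : ℚ)) + monoExp n i₂ (-1 / (d : ℚ)))
      (soleExp i₁ i₂ d m) = (1 / d : ℂ) * (bracketValue d 1 N m : ℂ) := by
  have hi' : (i₁ : ℕ) < i₂ := hi
  have hd' : d ≠ 0 := by omega
  have hd0 : (d : ℚ) ≠ 0 := Nat.cast_ne_zero.2 hd'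
  set u := monoExp n i₁ (1 / (d : ℚ)) + monoExp n i₂ (-1 / (d : ℚ)) with hu
  have hu1 : u i₁ = 1 / d := by simp [hu, monoExp, hi'.ne]
  have hu2 : u i₂ = -(((1 : ℕ) : ℚ) / d) := by simp [hu, monoExp, hi'.ne', neg_div]
  rw [soleExp, (isStartExponent_first hi hd).bracketSeries_eq hi hd m
    (N - ∑ j, (m j : ℤ)) (-N), ← hu, hu1, hu2, ← gammaCoeff_mul_eq_bracketValue hd' le_rfl N hm,
    gammaCoeff_eq_mul (u := 1 / d) (fun _ _ => by positivity), sub_add_eq_add_sub]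
  · push_cast; ring
  · rw [← hu, hu1, hs]; push_cast; field_simp; ring
  · rw [← hu, hu2, hs]; push_cast; field_simp; ring

theorem bracketSeries_last_eq (hi : i₁ < i₂) (hd : d = (i₂ : ℕ) - (i₁ : ℕ))
    (h0 : (i₁ : ℕ) ≠ 0) (m : OtherIndex i₁ i₂ →₀ ℕ) {N : ℤ}
    (hs : rootWeight i₁ i₂ m = d * N) :
    bracketSeries (monoExp n (i₁ - 1) 1 + monoExp n i₁ (-1)) (soleExp i₁ i₂ d m) =
      ((gammaCoeff (-1) (N + 1 - ∑ j, (m j : ℤ)) * gammaCoeff 0 (-N)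
        * (∏ j, ((m j).factorial : ℚ))⁻¹ : ℚ) : ℂ) := by
  have hi' : (i₁ : ℕ) < i₂ := hi
  have hd' : d ≠ 0 := by omega
  have hd0 : (d : ℚ) ≠ 0 := Nat.cast_ne_zero.2 hd'
  set u := monoExp n (i₁ - 1) 1 + monoExp n i₁ (-1) with hu
  have hu1 : u i₁ = -1 := by simp [hu, monoExp, show ¬ (i₁ : ℕ) = i₁ - 1 by omega]
  have hu2 : u i₂ = 0 := by simp [hu, monoExp, hi'.ne', show ¬ (i₂ : ℕ) = i₁ - 1 by omega]
  rw [soleExp, (isStartExponent_last hi hd' h0).bracketSeries_eq hi hd m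
    (N + 1 - ∑ j, (m j : ℤ)) (-N), ← hu, hu1, hu2]
  · rw [← hu, hu1, hs]; push_cast; field_simp; ring
  · rw [← hu, hu2, hs]; push_cast; field_simp; ring

/-- The coefficient predicted by Lagrange inversion, up to a power of `ξ`. -/
def lagrangeValue (d : ℕ) (m : OtherIndex i₁ i₂ →₀ ℕ) : ℚ :=
  (∏ j ∈ Finset.range (∑ i, m i - 1), ((rootWeight i₁ i₂ m : ℚ) / d - (j + 1)))
    * (∏ j, ((m j).factorial : ℚ))⁻¹

theorem bracketValue_eq (hd : d ≠ 0) {k : ℕ} {m : OtherIndex i₁ i₂ →₀ ℕ} {N : ℤ}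
    (hs : rootWeight i₁ i₂ m = k + d * N) :
    bracketValue d k N m = gammaCoeff ((k : ℚ) / d - 1) N * gammaCoeff (-((k : ℚ) / d)) (-N)
      * lagrangeValue d m := by
  have hd0 : (d : ℚ) ≠ 0 := Nat.cast_ne_zero.2 hd
  have : (rootWeight i₁ i₂ m : ℚ) / d = (k : ℚ) / d + N := by
    rw [hs]; push_cast; field_simp
  rw [bracketValue, lagrangeValue, this]
  ring

/-- If `d` does not divide the weight, the reflection formula evaluates the only bracket that
contributes. -/
theorem bracketValue_of_lt {k : ℕ} (hk : 1 ≤ k) (hkd : k < d) {m : OtherIndex i₁ i₂ →₀ ℕ} {N : ℤ}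
    (hs : rootWeight i₁ i₂ m = k + d * N) :
    bracketValue d k N m = (-1) ^ N * lagrangeValue d m := by
  have hd0 : (0 : ℚ) < d := by exact_mod_cast (by omega : 0 < d)
  rw [bracketValue_eq (by omega) hs, gammaCoeff_reflection]
  intro w hw
  have h1 : (0 : ℚ) < w := by rw [← hw]; positivity
  have h2 : (w : ℚ) < 1 := by
    rw [← hw, div_lt_one hd0]; exact_mod_cast hkd
  have h3 : 0 < w := by exact_mod_cast h1
  have h4 : w < 1 := by exact_mod_cast h2
  omega

theorem bracketValue_self (hd : d ≠ 0) {m : OtherIndex i₁ i₂ →₀ ℕ} {N : ℤ}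
    (hs : rootWeight i₁ i₂ m = d + d * N) :
    bracketValue d d N m = if 0 ≤ N then (-1) ^ N * lagrangeValue d m else 0 := by
  have hd0 : (d : ℚ) ≠ 0 := Nat.cast_ne_zero.2 hd
  rw [bracketValue_eq hd hs, div_self hd0, sub_self]
  split_ifs with hN
  · lift N to ℕ using hN
    rw [gammaCoeff_zero_mul_neg_one, zpow_natCast]
  · rw [gammaCoeff_neg_one_of_pos (by omega)]
    ring

/-- If `d` divides the weight of `m`, the last bracket supplies the coefficient in exactly the
cases in which the bracket with `k = d` vanishes. -/
theorem bracketSeries_last_eq_ite (hi : i₁ < i₂) (hd : d = (i₂ : ℕ) - (i₁ : ℕ))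
    {m : OtherIndex i₁ i₂ →₀ ℕ} (hm : m ≠ 0) {N : ℤ} (hs : rootWeight i₁ i₂ m = d + d * N) :
    (if (i₁ : ℕ) = 0 then 0
      else bracketSeries (monoExp n (i₁ - 1) 1 + monoExp n i₁ (-1)) (soleExp i₁ i₂ d m)) =
      if 0 ≤ N then 0 else (((-1) ^ (N + 1) * lagrangeValue d m : ℚ) : ℂ) := by
  have hi' : (i₁ : ℕ) < i₂ := hi
  have hd' : 0 < d := by omega
  have hd0 : (d : ℚ) ≠ 0 := Nat.cast_ne_zero.2 hd'.ne'
  by_cases h0 : (i₁ : ℕ) = 0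
  · -- All weights are positive in this case.
    have hpos : 0 < rootWeight i₁ i₂ m := by
      rw [rootWeight, h0]
      have : 0 ≤ ∑ j : OtherIndex i₁ i₂, (((j.1 : ℕ) : ℤ) - (0 : ℕ)) * (m j : ℤ) :=
        Finset.sum_nonneg fun j _ => by simp; positivity
      omega
    have hN : 0 ≤ N := by
      rw [hs] at hpos
      by_contra hN
      have : (d : ℤ) * (1 + N) ≤ 0 := mul_nonpos_of_nonneg_of_nonpos (by omega) (by omega)
      linarith
    simp [h0, hN]
  rw [if_neg h0, bracketSeries_last_eq hi hd h0 m (N := N + 1) (by rw [hs]; ring)]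
  split_ifs with hN
  · have : gammaCoeff 0 (-(N + 1)) = 0 := by
      exact_mod_cast gammaCoeff_nat_of_add_neg (a := 0) (v := -(N + 1)) (by simp; omega)
    rw [this]
    simp
  · obtain ⟨K, hK⟩ : ∃ K : ℕ, N + 1 = -K := ⟨(N + 1).natAbs, by omega⟩
    have hM : 1 ≤ ∑ j, m j := by
      rw [Nat.one_le_iff_ne_zero, Ne, Finset.sum_eq_zero_iff]
      exact fun h => hm (Finsupp.ext fun j => h j (Finset.mem_univ _))
    have harg : -(K : ℤ) + 1 - ∑ j, (m j : ℤ) = -(K : ℤ) - ((∑ j, m j - 1 : ℕ) : ℤ) := by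
      rw [Nat.cast_sub hM]; push_cast; ring
    have hdiv : (rootWeight i₁ i₂ m : ℚ) / d = -K := by
      rw [hs, show (d : ℤ) + d * N = d * (N + 1) by ring, hK]; push_cast; field_simp
    have hrefl := gammaCoeff_zero_mul_neg_one K
    rw [hK, harg, gammaCoeff_sub_natCast (fun _ _ _ => by omega), neg_neg, lagrangeValue, hdiv,
      zpow_neg, zpow_natCast, ← inv_pow, inv_neg, inv_one, ← hrefl]
    congr 1
    push_cast
    simp only [neg_add_cancel, zero_add]
    ring

theorem sturmfelsSeries_soleExp (hi : i₁ < i₂) (hd : d = (i₂ : ℕ) - (i₁ : ℕ)) {ξ : ℂ}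
    (hξ : ξ ^ d = -1) {m : OtherIndex i₁ i₂ →₀ ℕ} (hm : m ≠ 0) :
    sturmfelsSeries n i₁ i₂ ξ (soleExp i₁ i₂ d m) =
      1 / d * ξ ^ rootWeight i₁ i₂ m * (lagrangeValue d m : ℂ) := by
  have hi' : (i₁ : ℕ) < i₂ := hi
  have hd' : 0 < d := by omega
  have hξ0 : ξ ≠ 0 := by
    rintro rfl
    simp [hd'.ne'] at hξ
  -- Write the weight as `k + d N` with `1 ≤ k ≤ d`.
  obtain ⟨k, N, hk1, hkd, hs⟩ : ∃ (k : ℕ) (N : ℤ), 1 ≤ k ∧ k ≤ d ∧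
      rootWeight i₁ i₂ m = k + d * N := by
    have h1 := Int.emod_nonneg (rootWeight i₁ i₂ m - 1) (by omega : (d : ℤ) ≠ 0)
    have h2 := Int.emod_lt_of_pos (rootWeight i₁ i₂ m - 1) (by omega : (0 : ℤ) < d)
    have h3 := Int.emod_add_mul_ediv (rootWeight i₁ i₂ m - 1) d
    refine ⟨((rootWeight i₁ i₂ m - 1) % d).toNat + 1, (rootWeight i₁ i₂ m - 1) / d,
      by omega, by omega, ?_⟩
    push_cast
    rw [Int.toNat_of_nonneg h1]
    linarith
  have hdvd : ∀ k' : ℕ, 1 ≤ k' → k' ≤ d → (d : ℤ) ∣ rootWeight i₁ i₂ m - k' → k' = k := by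
    intro k' h1 h2 h3
    rw [hs, show (k : ℤ) + d * N - k' = (k - k') + d * N by ring,
      Int.dvd_add_left (Dvd.intro _ rfl)] at h3
    have := Int.eq_zero_of_abs_lt_dvd h3 (by rw [abs_lt]; omega)
    omega
  have hpow : ξ ^ rootWeight i₁ i₂ m = ξ ^ k * (-1) ^ N := by
    rw [hs, zpow_add₀ hξ0, zpow_mul, zpow_natCast, zpow_natCast, hξ]
  have hmain : ξ * bracketSeries (monoExp n i₁ (1 / (d : ℚ)) + monoExp n i₂ (-1 / (d : ℚ)))
        (soleExp i₁ i₂ d m)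
      + (1 / (d : ℂ)) * ∑ k ∈ Finset.Icc 2 d, ξ ^ k *
          bracketSeries (monoExp n i₁ (((k : ℚ) - (d : ℚ)) / (d : ℚ)) + monoExp n (i₁ + k - 1) 1
            + monoExp n i₂ (-(k : ℚ) / (d : ℚ))) (soleExp i₁ i₂ d m) =
      1 / d * ξ ^ k * (bracketValue d k N m : ℂ) := by
    rcases Nat.eq_or_lt_of_le hk1 with rfl | hk2
    · rw [bracketSeries_first_eq hi hd hm (by simpa using hs), Finset.sum_eq_zero]
      · ring
      · intro k' hk'
        rw [Finset.mem_Icc] at hk'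
        rw [bracketSeries_middle_eq_zero hi hd hk'.1 hk'.2, mul_zero]
        intro h
        have := hdvd k' (by omega) hk'.2 h
        omega
    · rw [bracketSeries_first_eq_zero hi hd, Finset.sum_eq_single k,
        bracketSeries_middle_eq hi hd hk2 hkd hm hs]
      · ring
      · intro k' hk' hne
        rw [Finset.mem_Icc] at hk'
        rw [bracketSeries_middle_eq_zero hi hd hk'.1 hk'.2, mul_zero]
        exact fun h => hne (hdvd k' (by omega) hk'.2 h)
      · intro h
        exact absurd (Finset.mem_Icc.2 ⟨hk2, hkd⟩) h
      · intro h
        have := hdvd 1 le_rfl hd' (by simpa using h)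
        omega
  rw [sturmfelsSeries_apply ξ _ hd, hmain, hpow]
  rcases Nat.eq_or_lt_of_le hkd with rfl | hkd
  · rw [bracketSeries_last_eq_ite hi hd hm hs, bracketValue_self hd'.ne' hs, hξ]
    split_ifs
    · push_cast; ring
    · push_cast
      rw [zpow_add₀ (by norm_num), zpow_one]
      ring
  · have hlast : ¬ (d : ℤ) ∣ rootWeight i₁ i₂ m := fun h => by
      have := hdvd d hd' le_rfl (dvd_sub_self_right.2 h)
      omega
    rw [bracketSeries_last_eq_zero hi hd hlast, bracketValue_of_lt hk1 hkd hs]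
    push_cast
    simp only [ite_self]
    ring

theorem sturmfelsSeries_soleExp_zero (hi : i₁ < i₂) (hd : d = (i₂ : ℕ) - (i₁ : ℕ)) (ξ : ℂ) :
    sturmfelsSeries n i₁ i₂ ξ (soleExp i₁ i₂ d 0) = ξ := by
  have hi' : (i₁ : ℕ) < i₂ := hi
  have hd' : 0 < d := by omega
  have hw : rootWeight i₁ i₂ 0 = 1 := by simp [rootWeight]
  have hfirst : bracketSeries (monoExp n i₁ (1 / (d : ℚ)) + monoExp n i₂ (-1 / (d : ℚ)))
      (soleExp i₁ i₂ d 0) = 1 := by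
    rw [soleExp, (isStartExponent_first hi hd).bracketSeries_eq hi hd 0 0 0]
    · simp [gammaCoeff_zero_right]
    · simp [hw, monoExp, hi'.ne]
    · simp [hw, monoExp, hi'.ne']
  have hlast : (if (i₁ : ℕ) = 0 then 0 else
      bracketSeries (monoExp n (i₁ - 1) 1 + monoExp n i₁ (-1)) (soleExp i₁ i₂ d 0)) = 0 := by
    split_ifs with h0
    · rfl
    by_cases hd1 : d = 1
    · rw [bracketSeries_last_eq hi hd h0 0 (N := 1) (by simp [hw, hd1]),
        gammaCoeff_neg_one_of_pos (by simp)]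
      simp
    · refine bracketSeries_last_eq_zero hi hd ?_
      rw [hw]
      intro h
      have := Int.le_of_dvd one_pos h
      omega
  rw [sturmfelsSeries_apply ξ _ hd, hfirst, hlast, Finset.sum_eq_zero]
  · simp
  · intro k hk
    rw [Finset.mem_Icc] at hk
    rw [bracketSeries_middle_eq_zero hi hd hk.1 hk.2, mul_zero]
    rw [hw]
    intro h
    have := Int.eq_zero_of_abs_lt_dvd h (by rw [abs_lt]; omega)
    omega

end Sturmfels

/-! ### Comparison of the two series -/

theorem LogSurface.pow_eq_exp (z : LogSurface) (γ : ℂ) : z.pow γ = Complex.exp (γ * z.log) := by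
  rw [LogSurface.pow, LogSurface.log]
  ring_nf

theorem mainTheorem5 (n : ℕ) (hn : 2 ≤ n) (i₁ i₂ : Fin (n + 1)) (hi : i₁ < i₂)
    (d : ℕ) (hd : d = (i₂ : ℕ) - (i₁ : ℕ))
    (c₁ c₂ : ℂ) (hc₁ : c₁ ≠ 0) (hc₂ : c₂ ≠ 0)
    (α : LogSurface) (hα : baseFunction (c₂ / c₁) (d : ℂ) α = 0)
    (U : Set (OtherIndex i₁ i₂ → ℂ)) (hU : U ∈ 𝓝 (0 : OtherIndex i₁ i₂ → ℂ))
    (φ : (OtherIndex i₁ i₂ → ℂ) → LogSurface) (hφ : SmoothToLogSurface φ U)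
    (hφ_root : ∀ c ∈ U, modifiedFunction (c₂ / c₁) (d : ℂ) c
      (fun i => ((i.1 : ℕ) : ℂ) - ((i₁ : ℕ) : ℂ)) (φ c) = 0)
    (hφ_zero : φ 0 = α)
    (ξ A B : ℂ) (hξ : ξ ^ d = -1) (hA : A ^ d = c₁) (hB : B ^ d = c₂)
    (hαξ : α.toComplex = ξ * (A / B)) :
    IsPowerSeriesOutside i₁ i₂ d (sturmfelsSeries n i₁ i₂ ξ) ∧
    taylorSeries (fun c : OtherIndex i₁ i₂ → ℂ => (φ (fun i => c i / c₁)).toComplex) =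
      specializeSeries i₁ i₂ d A B (sturmfelsSeries n i₁ i₂ ξ) := by
  refine ⟨isPowerSeriesOutside_sturmfelsSeries hi hd ξ, ?_⟩
  have hi' : (i₁ : ℕ) < i₂ := hi
  have hd0 : d ≠ 0 := by omega
  have hdC : (d : ℂ) ≠ 0 := Nat.cast_ne_zero.2 hd0
  have hA0 : A ≠ 0 := by
    rintro rfl
    exact hc₁ (by rw [← hA, zero_pow hd0])
  have hB0 : B ≠ 0 := by
    rintro rfl
    exact hc₂ (by rw [← hB, zero_pow hd0])
  -- The logarithm of the root, in the rescaled coordinates.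
  set t : (OtherIndex i₁ i₂ → ℂ) → ℂ := fun c => (φ fun i => c i / c₁).log with ht
  set V : Set (OtherIndex i₁ i₂ → ℂ) := (fun c i => c i / c₁) ⁻¹' interior U with hV
  have hscale : ContDiff ℂ ∞ (fun (c : OtherIndex i₁ i₂ → ℂ) i => c i / c₁) :=
    contDiff_pi.2 fun i => (contDiff_apply ℂ ℂ i).div_const c₁
  have hVo : IsOpen V := isOpen_interior.preimage hscale.continuous
  have h0V : (0 : OtherIndex i₁ i₂ → ℂ) ∈ V := by
    have : (fun i => (0 : OtherIndex i₁ i₂ → ℂ) i / c₁) = 0 := by ext; simp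
    rw [hV, Set.mem_preimage, this]
    exact mem_interior_iff_mem_nhds.2 hU
  have htV : ContDiffOn ℂ ∞ t V :=
    (hφ.mono interior_subset).comp hscale.contDiffOn fun _ h => h
  have hroot : ∀ c ∈ V, c₁ + c₂ * Complex.exp ((d : ℂ) * t c) +
      ∑ j : OtherIndex i₁ i₂, c j *
        Complex.exp ((((j.1 : ℕ) : ℂ) - ((i₁ : ℕ) : ℂ)) * t c) = 0 := by
    intro c hc
    have h := hφ_root _ (interior_subset hc)
    simp only [modifiedFunction, baseFunction, LogSurface.pow_eq_exp] at h
    have hsum : ∑ j : OtherIndex i₁ i₂, c j *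
        Complex.exp ((((j.1 : ℕ) : ℂ) - ((i₁ : ℕ) : ℂ)) * t c) =
        c₁ * ∑ j : OtherIndex i₁ i₂, c j / c₁ *
          Complex.exp ((((j.1 : ℕ) : ℂ) - ((i₁ : ℕ) : ℂ)) * t c) := by
      rw [Finset.mul_sum]
      exact Finset.sum_congr rfl fun j _ => by field_simp
    rw [hsum]
    have h' := congrArg (c₁ * ·) h
    simp only [mul_add, mul_zero] at h'
    rw [← h', ← mul_assoc, mul_div_cancel₀ _ hc₁, mul_one]
  have hψ : (fun c : OtherIndex i₁ i₂ → ℂ => (φ fun i => c i / c₁).toComplex) =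
      fun c => Complex.exp (1 * t c) := by
    ext c
    rw [LogSurface.toComplex, LogSurface.pow_eq_exp]
  have ht0 : Complex.exp (t 0) = ξ * (A / B) := by
    have : (fun i => (0 : OtherIndex i₁ i₂ → ℂ) i / c₁) = 0 := by ext; simp
    rw [← hαξ, ht, LogSurface.toComplex, LogSurface.pow_eq_exp, one_mul]
    simp only [this, hφ_zero]
  ext m
  change iteratedPartial m _ 0 / _ = specializeSeries i₁ i₂ d A B _ m
  rw [hψ, specializeSeries_sturmfelsSeries hi hd]
  by_cases hm : m = 0
  · subst hm
    rw [iteratedPartial_zero, sturmfelsSeries_soleExp_zero hi hd, one_mul, ht0]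
    simp [rootWeight]
    ring
  have hweight : 1 + ∑ j : OtherIndex i₁ i₂, (((j.1 : ℕ) : ℂ) - ((i₁ : ℕ) : ℂ)) * (m j : ℂ) =
      (rootWeight i₁ i₂ m : ℂ) := by
    rw [rootWeight]; push_cast; rfl
  have hM : (d : ℤ) * ∑ j, (m j : ℤ) = ((d * ∑ j, m j : ℕ) : ℤ) := by push_cast; rfl
  rw [iteratedPartial_exp_root hVo h0V htV hroot hdC hc₁ hm, hweight, Complex.exp_int_mul, ht0,
    sturmfelsSeries_soleExp hi hd hξ hm, lagrangeValue, mul_zpow, div_zpow, hM,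
    zpow_sub₀ hA0, zpow_neg, zpow_natCast, pow_mul, hA]
  push_cast
  field_simp
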